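/- Let $M$ be a smooth ($C^\infty$) manifold without boundary that is Hausdorff, paracompact and connected. A hermitian line bundle over $M$ is a smooth complex vector bundle $L\to M$ of rank one together with a hermitian inner product $\langle\cdot,\cdot\rangle$ on each fibre such that $\langle r,s\rangle$ is a smooth function for all smooth (local) sections $r,s$ of $L$. Two hermitian line bundles $L,L'$ over $M$ are equivalent if there is a diffeomorphism $\phi:L\to L'$ of total spaces that covers the identity of $M$ and restricts, for every $p\in M$, to a complex linear isometry $L_p\to L'_p$. Let $\mathcal{L}_h(M)$ be the set of equivalence classes of hermitian line bundles over $M$; the tensor product of hermitian line bundles makes it an abelian group, whose identity is the class of the trivial bundle $\mathbb{C}\times M$. Let $\check H^2(M;\mathbb{Z})$ be the second Čech cohomology group of $M$ with coefficients in the constant sheaf $\mathbb{Z}$, i.e. the direct limit, over the open covers of $M$, of the second cohomology groups of their Čech complexes. Then there is an isomorphism of groups $$\mathcal{L}_h(M)\;\cong\;\check H^2(M;\mathbb{Z}).$$ -/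

import Mathlib

open scoped Manifold ContDiff Topology TensorProduct InnerProductSpace
open Bundle

noncomputable section

/-! ### Smooth hermitian line bundles -/

section

variable {M : Type*} [TopologicalSpace M] {F : Type*} [NormedAddCommGroup F] [NormedSpace ℂ F]
  {V : M → Type*} [TopologicalSpace (TotalSpace F V)] [∀ x, NormedAddCommGroup (V x)]
  [∀ x, NormedSpace ℂ (V x)] [FiberBundle F V] [VectorBundle ℂ F V]

lemma Bundle.Trivialization.isLinear_real (e : Trivialization F (π F V))
    [MemTrivializationAtlas e] : e.IsLinear ℝ :=
  ⟨fun b hb ↦ ⟨(e.linear ℂ hb).map_add, fun c v ↦ by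
    have h := (e.linear ℂ hb).map_smul (c : ℂ) v
    simpa only [Complex.coe_smul] using h⟩⟩

/-- A complex vector bundle is a real vector bundle by restriction of scalars. -/
instance VectorBundle.restrictScalarsReal : VectorBundle ℝ F V where
  trivialization_linear' e _ := e.isLinear_real
  continuousOn_coordChange' e e' _ _ := by
    have := e.isLinear_real
    have := e'.isLinear_real
    have h : ContinuousOn (fun b ↦ ContinuousLinearMap.restrictScalarsL ℂ F F ℝ ℝ
        (e.coordChangeL ℂ e' b : F →L[ℂ] F)) (e.baseSet ∩ e'.baseSet) :=
      (ContinuousLinearMap.continuous _).comp_continuousOn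
        (VectorBundle.continuousOn_coordChange' (R := ℂ) e e')
    refine h.congr fun b hb ↦ ?_
    ext v
    rw [ContinuousLinearEquiv.coe_coe, Trivialization.coordChangeL_apply e e' hb]
    exact (Trivialization.coordChangeL_apply (R := ℂ) e e' hb v).symm

end

/-- The product of smooth complex-valued functions on a real manifold is smooth. -/
lemma ContMDiffWithinAt.complex_mul {E H N : Type*} [NormedAddCommGroup E] [NormedSpace ℝ E]
    [TopologicalSpace H] {I : ModelWithCorners ℝ E H} [TopologicalSpace N] [ChartedSpace H N]
    {f g : N → ℂ} {s : Set N} {x : N} (hf : ContMDiffWithinAt I 𝓘(ℝ, ℂ) ∞ f s x)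
    (hg : ContMDiffWithinAt I 𝓘(ℝ, ℂ) ∞ g s x) :
    ContMDiffWithinAt I 𝓘(ℝ, ℂ) ∞ (fun y ↦ f y * g y) s x :=
  ((ContinuousLinearMap.mul ℝ ℂ).contMDiff.contMDiffAt.comp_contMDiffWithinAt x hf).clm_apply hg

/-- A smooth hermitian line bundle over a smooth manifold `M` of dimension `n`: a complex vector
bundle with model fibre `ℂ` whose transition functions are smooth, with a hermitian inner product
on each fibre for which the inner product of any two smooth local sections is a smooth function. -/
structure HermitianLineBundle (n : ℕ) (M : Type*) [TopologicalSpace M]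
    [ChartedSpace (EuclideanSpace ℝ (Fin n)) M] where
  /-- The fibre over a point. -/
  Fiber : M → Type
  [normedAddCommGroup : ∀ x, NormedAddCommGroup (Fiber x)]
  [innerProductSpace : ∀ x, InnerProductSpace ℂ (Fiber x)]
  [topologicalSpace : TopologicalSpace (TotalSpace ℂ Fiber)]
  [fiberBundle : FiberBundle ℂ Fiber]
  [vectorBundle : VectorBundle ℂ ℂ Fiber]
  [contMDiffVectorBundle : ContMDiffVectorBundle ∞ ℂ Fiber (𝓡 n)]
  contMDiffOn_inner : ∀ (U : Set M), IsOpen U → ∀ s t : ∀ x, Fiber x,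
    ContMDiffOn (𝓡 n) ((𝓡 n).prod 𝓘(ℝ, ℂ)) ∞ (fun x ↦ TotalSpace.mk' ℂ x (s x)) U →
    ContMDiffOn (𝓡 n) ((𝓡 n).prod 𝓘(ℝ, ℂ)) ∞ (fun x ↦ TotalSpace.mk' ℂ x (t x)) U →
    ContMDiffOn (𝓡 n) 𝓘(ℝ, ℂ) ∞ (fun x ↦ ⟪s x, t x⟫_ℂ) U

namespace HermitianLineBundle

attribute [instance] normedAddCommGroup innerProductSpace topologicalSpace fiberBundle
  vectorBundle contMDiffVectorBundle

variable {n : ℕ} {M : Type*} [TopologicalSpace M] [ChartedSpace (EuclideanSpace ℝ (Fin n)) M]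

/-- A hermitian bundle diffeomorphism: a diffeomorphism between the total spaces that covers the
identity of `M` and is a complex linear isometry between the fibres over each point. -/
structure HermitianEquiv (L L' : HermitianLineBundle n M) where
  fiberEquiv : ∀ x, L.Fiber x ≃ₗᵢ[ℂ] L'.Fiber x
  contMDiff_toFun : ContMDiff ((𝓡 n).prod 𝓘(ℝ, ℂ)) ((𝓡 n).prod 𝓘(ℝ, ℂ)) ∞
    (fun p : TotalSpace ℂ L.Fiber ↦ TotalSpace.mk' ℂ p.1 (fiberEquiv p.1 p.2))
  contMDiff_invFun : ContMDiff ((𝓡 n).prod 𝓘(ℝ, ℂ)) ((𝓡 n).prod 𝓘(ℝ, ℂ)) ∞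
    (fun p : TotalSpace ℂ L'.Fiber ↦ TotalSpace.mk' ℂ p.1 ((fiberEquiv p.1).symm p.2))

/-- Two hermitian line bundles are equivalent if there is a hermitian bundle diffeomorphism between
them. -/
instance setoid (n : ℕ) (M : Type*) [TopologicalSpace M]
    [ChartedSpace (EuclideanSpace ℝ (Fin n)) M] : Setoid (HermitianLineBundle n M) where
  r L L' := Nonempty (HermitianEquiv L L')
  iseqv :=
    { refl := fun _ ↦ ⟨⟨fun _ ↦ .refl ℂ _, contMDiff_id, contMDiff_id⟩⟩
      symm := fun ⟨φ⟩ ↦ ⟨⟨fun x ↦ (φ.fiberEquiv x).symm, φ.contMDiff_invFun, φ.contMDiff_toFun⟩⟩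
      trans := fun ⟨φ⟩ ⟨ψ⟩ ↦ ⟨⟨fun x ↦ (φ.fiberEquiv x).trans (ψ.fiberEquiv x),
        ψ.contMDiff_toFun.comp φ.contMDiff_toFun, φ.contMDiff_invFun.comp ψ.contMDiff_invFun⟩⟩ }

end HermitianLineBundle

/-- A family of one-dimensional hermitian spaces with an atlas of local unitary frames whose
transition functions are smooth. -/
structure UnitaryFrameAtlas (n : ℕ) {M : Type*} [TopologicalSpace M]
    [ChartedSpace (EuclideanSpace ℝ (Fin n)) M] (V : M → Type) [∀ x, NormedAddCommGroup (V x)]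
    [∀ x, InnerProductSpace ℂ (V x)] (ι : Type*) where
  dom : ι → Set M
  isOpen_dom : ∀ i, IsOpen (dom i)
  frame : ι → ∀ x, V x
  norm_frame : ∀ i, ∀ x ∈ dom i, ‖frame i x‖ = 1
  inner_smul_frame : ∀ i, ∀ x ∈ dom i, ∀ v : V x, ⟪frame i x, v⟫_ℂ • frame i x = v
  idx : M → ι
  mem_dom_idx : ∀ x, x ∈ dom (idx x)
  contMDiffOn_inner : ∀ i j, ContMDiffOn (𝓡 n) 𝓘(ℝ, ℂ) ∞
    (fun x ↦ ⟪frame j x, frame i x⟫_ℂ) (dom i ∩ dom j)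

namespace UnitaryFrameAtlas

variable {n : ℕ} {M : Type*} [TopologicalSpace M] [ChartedSpace (EuclideanSpace ℝ (Fin n)) M]
  {V : M → Type} [∀ x, NormedAddCommGroup (V x)] [∀ x, InnerProductSpace ℂ (V x)] {ι : Type*}
  (A : UnitaryFrameAtlas n V ι)

lemma inner_frame_self {i : ι} {x : M} (hx : x ∈ A.dom i) :
    ⟪A.frame i x, A.frame i x⟫_ℂ = 1 := by
  rw [inner_self_eq_norm_sq_to_K, A.norm_frame i x hx]; simp

/-- The local trivialisation `v ↦ ⟪s, v⟫` given by a unitary frame `s`. -/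
def pretriv (i : ι) : Pretrivialization ℂ (π ℂ V) where
  toFun p := (p.1, ⟪A.frame i p.1, p.2⟫_ℂ)
  invFun q := ⟨q.1, q.2 • A.frame i q.1⟩
  source := π ℂ V ⁻¹' A.dom i
  target := A.dom i ×ˢ Set.univ
  map_source' p hp := ⟨hp, trivial⟩
  map_target' q hq := hq.1
  left_inv' := by
    rintro ⟨x, v⟩ hx
    simp only [A.inner_smul_frame i x hx v]
  right_inv' := by
    rintro ⟨x, z⟩ ⟨hx, -⟩
    simp only [inner_smul_right, A.inner_frame_self hx, mul_one]
  open_target := (A.isOpen_dom i).prod isOpen_univ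
  baseSet := A.dom i
  open_baseSet := A.isOpen_dom i
  source_eq := rfl
  target_eq := rfl
  proj_toFun _ _ := rfl

lemma pretriv_symm {i : ι} {x : M} (hx : x ∈ A.dom i) (z : ℂ) :
    (A.pretriv i).symm x z = z • A.frame i x := by
  have h := (A.pretriv i).mk_symm (b := x) hx z
  have h2 : ((A.pretriv i).toPartialEquiv.symm (x, z)) =
    (⟨x, z • A.frame i x⟩ : TotalSpace ℂ V) := rfl
  rw [h2] at h
  simpa using h

lemma pretriv_coord {i j : ι} {x : M} (hx : x ∈ A.dom i) (z : ℂ) :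
    (A.pretriv j ⟨x, (A.pretriv i).symm x z⟩).2 = ⟪A.frame j x, A.frame i x⟫_ℂ * z := by
  rw [A.pretriv_symm hx]
  change ⟪A.frame j x, z • A.frame i x⟫_ℂ = _
  rw [inner_smul_right, mul_comm]

/-- The vector bundle structure given by an atlas of unitary frames. -/
def prebundle : VectorPrebundle ℂ ℂ V where
  pretrivializationAtlas := Set.range A.pretriv
  pretrivialization_linear' := by
    rintro _ ⟨i, rfl⟩
    exact ⟨fun x _ ↦ ⟨fun v w ↦ inner_add_right _ _ _, fun c v ↦ inner_smul_right _ _ _⟩⟩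
  pretrivializationAt x := A.pretriv (A.idx x)
  mem_base_pretrivializationAt := A.mem_dom_idx
  pretrivialization_mem_atlas x := ⟨_, rfl⟩
  exists_coordChange := by
    rintro _ ⟨i, rfl⟩ _ ⟨j, rfl⟩
    refine ⟨fun x ↦ ContinuousLinearMap.mul ℂ ℂ ⟪A.frame j x, A.frame i x⟫_ℂ, ?_, ?_⟩
    · exact (ContinuousLinearMap.continuous _).comp_continuousOn
        (A.contMDiffOn_inner i j).continuousOn
    · intro x hx z
      rw [A.pretriv_coord hx.1]
      rfl
  totalSpaceMk_isInducing x := by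
    have hx := A.mem_dom_idx x
    have h1 : Topology.IsInducing (fun v : V x ↦ ⟪A.frame (A.idx x) x, v⟫_ℂ) := by
      have : Isometry (fun v : V x ↦ ⟪A.frame (A.idx x) x, v⟫_ℂ) := by
        refine AddMonoidHomClass.isometry_of_norm
          (innerSL ℂ (A.frame (A.idx x) x) : V x →L[ℂ] ℂ) fun v ↦ ?_
        conv_rhs => rw [← A.inner_smul_frame _ x hx v, norm_smul, A.norm_frame _ x hx, mul_one]
        rfl
      exact this.isEmbedding.isInducing
    refine Topology.IsInducing.of_comp (g := Prod.snd) ?_ continuous_snd h1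
    exact continuous_const.prodMk h1.continuous

/-- The hermitian line bundle given by an atlas of unitary frames. -/
def toBundle : HermitianLineBundle n M :=
  letI := A.prebundle.totalSpaceTopology
  letI := A.prebundle.toFiberBundle
  haveI : VectorBundle ℂ ℂ V := A.prebundle.toVectorBundle
  haveI : ContMDiffVectorBundle ∞ ℂ V (𝓡 n) := by
    constructor
    intro e e' he he'
    have hl := e.isLinear_real
    have hl' := e'.isLinear_real
    obtain ⟨_, ⟨i, rfl⟩, rfl⟩ := he
    obtain ⟨_, ⟨j, rfl⟩, rfl⟩ := he'
    have h := (ContinuousLinearMap.mul ℝ ℂ).contMDiff.comp_contMDiffOn (A.contMDiffOn_inner i j)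
    refine h.congr fun x hx ↦ ?_
    ext1 z
    rw [ContinuousLinearEquiv.coe_coe, Trivialization.coordChangeL_apply _ _ hx]
    exact A.pretriv_coord hx.1 z
  { Fiber := V
    contMDiffOn_inner := by
      intro U hU s t hs ht x hx
      have hs' := ((contMDiffAt_section x).1 ((hs x hx).contMDiffAt (hU.mem_nhds hx)))
      have ht' := ((contMDiffAt_section x).1 ((ht x hx).contMDiffAt (hU.mem_nhds hx)))
      change ContMDiffAt (𝓡 n) 𝓘(ℝ, ℂ) ∞ (fun y ↦ ⟪A.frame (A.idx x) y, s y⟫_ℂ) x at hs'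
      change ContMDiffAt (𝓡 n) 𝓘(ℝ, ℂ) ∞ (fun y ↦ ⟪A.frame (A.idx x) y, t y⟫_ℂ) x at ht'
      have h := ((Complex.conjCLE : ℂ →L[ℝ] ℂ).contMDiff.contMDiffAt.comp_contMDiffWithinAt x hs').complex_mul ht'
      refine (ContMDiffAt.congr_of_eventuallyEq h ?_).contMDiffWithinAt
      filter_upwards [(A.isOpen_dom _).mem_nhds (A.mem_dom_idx x)] with y hy
      conv_lhs => rw [← A.inner_smul_frame _ y hy (s y), inner_smul_left]
      rfl }

end UnitaryFrameAtlas

namespace HermitianLineBundle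

variable {n : ℕ} {M : Type*} [TopologicalSpace M] [ChartedSpace (EuclideanSpace ℝ (Fin n)) M]

/-- A smooth local section of length one. -/
structure UnitaryFrame (L : HermitianLineBundle n M) where
  dom : Set M
  isOpen_dom : IsOpen dom
  frame : ∀ x, L.Fiber x
  norm_frame : ∀ x ∈ dom, ‖frame x‖ = 1
  contMDiffOn_frame : ContMDiffOn (𝓡 n) ((𝓡 n).prod 𝓘(ℝ, ℂ)) ∞
    (fun x ↦ TotalSpace.mk' ℂ x (frame x)) dom

lemma finrank_fiber (L : HermitianLineBundle n M) (x : M) : Module.finrank ℂ (L.Fiber x) = 1 := by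
  rw [((trivializationAt ℂ L.Fiber x).linearEquivAt ℂ x
    (mem_baseSet_trivializationAt ℂ L.Fiber x)).finrank_eq, Module.finrank_self]

namespace UnitaryFrame

variable {L : HermitianLineBundle n M}

lemma inner_self (s : L.UnitaryFrame) {x : M} (hx : x ∈ s.dom) :
    ⟪s.frame x, s.frame x⟫_ℂ = 1 := by
  rw [inner_self_eq_norm_sq_to_K, s.norm_frame x hx]; simp

lemma inner_smul (s : L.UnitaryFrame) {x : M} (hx : x ∈ s.dom) (v : L.Fiber x) :
    ⟪s.frame x, v⟫_ℂ • s.frame x = v := by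
  have h0 : s.frame x ≠ 0 := by
    intro h
    have := s.norm_frame x hx
    simp [h] at this
  obtain ⟨c, rfl⟩ := exists_smul_eq_of_finrank_eq_one (L.finrank_fiber x) h0 v
  rw [inner_smul_right, s.inner_self hx, mul_one]

lemma contMDiffOn_inner (s t : L.UnitaryFrame) : ContMDiffOn (𝓡 n) 𝓘(ℝ, ℂ) ∞
    (fun x ↦ ⟪t.frame x, s.frame x⟫_ℂ) (s.dom ∩ t.dom) :=
  L.contMDiffOn_inner _ (s.isOpen_dom.inter t.isOpen_dom) _ _
    (t.contMDiffOn_frame.mono Set.inter_subset_right)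
    (s.contMDiffOn_frame.mono Set.inter_subset_left)

end UnitaryFrame

lemma exists_unitaryFrame (L : HermitianLineBundle n M) (x : M) :
    ∃ s : L.UnitaryFrame, x ∈ s.dom := by
  let e := trivializationAt ℂ L.Fiber x
  let r : ∀ y, L.Fiber y := fun y ↦ e.symm y 1
  have he : ∀ y ∈ e.baseSet, e ⟨y, r y⟩ = (y, 1) := fun y hy ↦ e.apply_mk_symm hy 1
  have hr0 : ∀ y ∈ e.baseSet, r y ≠ 0 := by
    intro y hy h
    have h1 := he y hy
    have h2 : e.linearEquivAt ℂ y hy (r y) = 1 := congrArg Prod.snd h1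
    rw [h, map_zero] at h2
    exact zero_ne_one h2
  have hr : ContMDiffOn (𝓡 n) ((𝓡 n).prod 𝓘(ℝ, ℂ)) ∞
      (fun y ↦ TotalSpace.mk' ℂ y (r y)) e.baseSet := by
    rw [e.contMDiffOn_section_baseSet_iff]
    refine (contMDiffOn_const (c := (1 : ℂ))).congr fun y hy ↦ ?_
    exact congrArg Prod.snd (he y hy)
  have hn : ContMDiffOn (𝓡 n) 𝓘(ℝ, ℝ) ∞ (fun y ↦ ‖r y‖⁻¹) e.baseSet := by
    have h1 := L.contMDiffOn_inner _ e.open_baseSet r r hr hr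
    intro y hy
    have h2 := Complex.reCLM.contMDiff.contMDiffAt.comp_contMDiffWithinAt y (h1 y hy)
    have h3 : ContDiffAt ℝ ∞ (fun t : ℝ ↦ (√t)⁻¹) ((⟪r y, r y⟫_ℂ).re) := by
      have h4 : ((⟪r y, r y⟫_ℂ).re) ≠ 0 := by
        have h5 : (⟪r y, r y⟫_ℂ).re = ‖r y‖ ^ 2 := inner_self_eq_norm_sq (𝕜 := ℂ) (r y)
        rw [h5]
        exact pow_ne_zero 2 (norm_ne_zero_iff.2 (hr0 y hy))
      refine (Real.contDiffAt_sqrt h4).inv ?_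
      rw [Real.sqrt_ne_zero']
      exact lt_of_le_of_ne (inner_self_nonneg (𝕜 := ℂ)) h4.symm
    refine (h3.contMDiffAt.comp_contMDiffWithinAt y h2).congr (fun z _ ↦ ?_) ?_
    · simp only [Function.comp]
      rw [norm_eq_sqrt_re_inner (𝕜 := ℂ)]; rfl
    · simp only [Function.comp]
      rw [norm_eq_sqrt_re_inner (𝕜 := ℂ)]; rfl
  refine ⟨⟨e.baseSet, e.open_baseSet, fun y ↦ ‖r y‖⁻¹ • r y, fun y hy ↦ ?_, ?_⟩,
    mem_baseSet_trivializationAt ℂ L.Fiber x⟩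
  · rw [norm_smul, norm_inv, norm_norm, inv_mul_cancel₀ (norm_ne_zero_iff.2 (hr0 y hy))]
  · exact hn.smul_section hr

/-- A fibrewise isometry that is smooth in unitary frames is smooth on the total space. -/
lemma contMDiff_of_frames {L L' : HermitianLineBundle n M}
    (φ : ∀ x, L.Fiber x ≃ₗᵢ[ℂ] L'.Fiber x)
    (h : ∀ x, ∃ s : L.UnitaryFrame, ∃ t : L'.UnitaryFrame, x ∈ s.dom ∧ x ∈ t.dom ∧
      ContMDiffAt (𝓡 n) 𝓘(ℝ, ℂ) ∞ (fun y ↦ ⟪t.frame y, φ y (s.frame y)⟫_ℂ) x) :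
    ContMDiff ((𝓡 n).prod 𝓘(ℝ, ℂ)) ((𝓡 n).prod 𝓘(ℝ, ℂ)) ∞
      (fun p : TotalSpace ℂ L.Fiber ↦ TotalSpace.mk' ℂ p.1 (φ p.1 p.2)) := by
  intro p
  obtain ⟨s, t, hs, ht, hst⟩ := h p.1
  have hproj : ContMDiffAt ((𝓡 n).prod 𝓘(ℝ, ℂ)) (𝓡 n) ∞
    (fun q : TotalSpace ℂ L.Fiber ↦ q.1) p := contMDiffAt_proj _
  rw [contMDiffAt_totalSpace]
  refine ⟨hproj, ?_⟩
  let e := trivializationAt ℂ L.Fiber p.1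
  let e' := trivializationAt ℂ L'.Fiber p.1
  have hp : p.1 ∈ e.baseSet := mem_baseSet_trivializationAt ℂ L.Fiber p.1
  have hp' : p.1 ∈ e'.baseSet := mem_baseSet_trivializationAt ℂ L'.Fiber p.1
  have h1 : ContMDiffAt ((𝓡 n).prod 𝓘(ℝ, ℂ)) 𝓘(ℝ, ℂ) ∞
      (fun q : TotalSpace ℂ L.Fiber ↦ (e q).2) p := (contMDiffAt_totalSpace.1 contMDiffAt_id).2
  have h2 : ContMDiffAt (𝓡 n) 𝓘(ℝ, ℂ) ∞ (fun y ↦ ⟪s.frame y, e.symm y 1⟫_ℂ) p.1 := by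
    have hr : ContMDiffOn (𝓡 n) ((𝓡 n).prod 𝓘(ℝ, ℂ)) ∞
        (fun y ↦ TotalSpace.mk' ℂ y (e.symm y 1)) e.baseSet := by
      rw [e.contMDiffOn_section_baseSet_iff]
      refine (contMDiffOn_const (c := (1 : ℂ))).congr fun y hy ↦ ?_
      exact congrArg Prod.snd (e.apply_mk_symm hy 1)
    have ho := s.isOpen_dom.inter e.open_baseSet
    exact (L.contMDiffOn_inner _ ho _ _ (s.contMDiffOn_frame.mono Set.inter_subset_left)
      (hr.mono Set.inter_subset_right)).contMDiffAt (ho.mem_nhds ⟨hs, hp⟩)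
  have h3 : ContMDiffAt (𝓡 n) 𝓘(ℝ, ℂ) ∞ (fun y ↦ (e' ⟨y, t.frame y⟩).2) p.1 :=
    (contMDiffAt_section _).1 (t.contMDiffOn_frame.contMDiffAt (t.isOpen_dom.mem_nhds ht))
  have h23 : ContMDiffAt (𝓡 n) 𝓘(ℝ, ℂ) ∞ (fun y ↦ ⟪s.frame y, e.symm y 1⟫_ℂ *
      (⟪t.frame y, φ y (s.frame y)⟫_ℂ * (e' ⟨y, t.frame y⟩).2)) p.1 :=
    h2.complex_mul (hst.complex_mul h3)
  have h4 := h1.complex_mul (ContMDiffAt.comp p h23 hproj)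
  refine ContMDiffAt.congr_of_eventuallyEq h4 ?_
  have hev : ∀ᶠ y in 𝓝 p.1, y ∈ s.dom ∧ y ∈ t.dom ∧ y ∈ e.baseSet ∧ y ∈ e'.baseSet := by
    filter_upwards [s.isOpen_dom.mem_nhds hs, t.isOpen_dom.mem_nhds ht, e.open_baseSet.mem_nhds hp,
      e'.open_baseSet.mem_nhds hp'] with y h1 h2 h3 h4 using ⟨h1, h2, h3, h4⟩
  filter_upwards [hproj.continuousAt.eventually hev] with q hq
  obtain ⟨y, v⟩ := q
  obtain ⟨hqs, hqt, hqe, hqe'⟩ := hq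
  change (e' ⟨y, φ y v⟩).2 = (e ⟨y, v⟩).2 * (⟪s.frame y, e.symm y 1⟫_ℂ *
    (⟪t.frame y, φ y (s.frame y)⟫_ℂ * (e' ⟨y, t.frame y⟩).2))
  have hv : v = (e ⟨y, v⟩).2 • e.symm y 1 := by
    apply (e.linearEquivAt ℂ y hqe).injective
    rw [map_smul]
    have : e.linearEquivAt ℂ y hqe (e.symm y 1) = 1 := congrArg Prod.snd (e.apply_mk_symm hqe 1)
    rw [this, smul_eq_mul, mul_one]
    rfl
  have hφ : φ y v = ((e ⟨y, v⟩).2 * (⟪s.frame y, e.symm y 1⟫_ℂ *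
      ⟪t.frame y, φ y (s.frame y)⟫_ℂ)) • t.frame y := by
    rw [mul_smul, mul_smul, t.inner_smul hqt, ← map_smul, s.inner_smul hqs, ← map_smul, ← hv]
  have hl : ∀ w : L'.Fiber y, (e' ⟨y, w⟩).2 = e'.linearEquivAt ℂ y hqe' w := fun _ ↦ rfl
  rw [hl, hφ, map_smul, ← hl, smul_eq_mul]
  ring

/-- A fibrewise isometry that is smooth in unitary frames is a hermitian bundle diffeomorphism. -/
def HermitianEquiv.ofFrames {L L' : HermitianLineBundle n M}
    (φ : ∀ x, L.Fiber x ≃ₗᵢ[ℂ] L'.Fiber x)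
    (h : ∀ x, ∃ s : L.UnitaryFrame, ∃ t : L'.UnitaryFrame, x ∈ s.dom ∧ x ∈ t.dom ∧
      ContMDiffAt (𝓡 n) 𝓘(ℝ, ℂ) ∞ (fun y ↦ ⟪t.frame y, φ y (s.frame y)⟫_ℂ) x) :
    HermitianEquiv L L' where
  fiberEquiv := φ
  contMDiff_toFun := contMDiff_of_frames φ h
  contMDiff_invFun := contMDiff_of_frames (fun x ↦ (φ x).symm) fun x ↦ by
    obtain ⟨s, t, hs, ht, hst⟩ := h x
    refine ⟨t, s, ht, hs, ?_⟩
    refine ((Complex.conjCLE : ℂ →L[ℝ] ℂ).contMDiff.contMDiffAt.comp x hst).congr_of_eventuallyEq ?_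
    refine .of_forall fun y ↦ ?_
    change ⟪s.frame y, (φ y).symm (t.frame y)⟫_ℂ =
      (starRingEnd ℂ) ⟪t.frame y, φ y (s.frame y)⟫_ℂ
    rw [inner_conj_symm, ← (φ y).inner_map_map, LinearIsometryEquiv.apply_symm_apply]

/-- Hermitian bundle diffeomorphisms are smooth in unitary frames. -/
lemma HermitianEquiv.contMDiffAt_inner {L L' : HermitianLineBundle n M} (φ : HermitianEquiv L L')
    (s : L.UnitaryFrame) (t : L'.UnitaryFrame) {x : M} (hs : x ∈ s.dom) (ht : x ∈ t.dom) :
    ContMDiffAt (𝓡 n) 𝓘(ℝ, ℂ) ∞ (fun y ↦ ⟪t.frame y, φ.fiberEquiv y (s.frame y)⟫_ℂ) x := by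
  have ho := s.isOpen_dom.inter t.isOpen_dom
  exact (L'.contMDiffOn_inner _ ho _ _ (t.contMDiffOn_frame.mono Set.inter_subset_right)
    (φ.contMDiff_toFun.comp_contMDiffOn (s.contMDiffOn_frame.mono
      Set.inter_subset_left))).contMDiffAt (ho.mem_nhds ⟨hs, ht⟩)

/-- The unitary frames of a bundle given by an atlas of unitary frames. -/
def _root_.UnitaryFrameAtlas.toUnitaryFrame {V : M → Type} [∀ x, NormedAddCommGroup (V x)]
    [∀ x, InnerProductSpace ℂ (V x)] {ι : Type*} (A : UnitaryFrameAtlas n V ι) (i : ι) :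
    A.toBundle.UnitaryFrame where
  dom := A.dom i
  isOpen_dom := A.isOpen_dom i
  frame := A.frame i
  norm_frame := A.norm_frame i
  contMDiffOn_frame := fun x hx ↦ by
    refine ContMDiffAt.contMDiffWithinAt ((contMDiffAt_section _).2 ?_)
    exact (A.contMDiffOn_inner i (A.idx x)).contMDiffAt
      (((A.isOpen_dom _).inter (A.isOpen_dom _)).mem_nhds ⟨hx, A.mem_dom_idx x⟩)

/-- The trivial hermitian line bundle `ℂ × M`, with its constant frame `1`. -/
def trivialAtlas (n : ℕ) (M : Type*) [TopologicalSpace M]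
    [ChartedSpace (EuclideanSpace ℝ (Fin n)) M] :
    UnitaryFrameAtlas n (fun _ : M ↦ ℂ) Unit where
  dom _ := Set.univ
  isOpen_dom _ := isOpen_univ
  frame _ _ := 1
  norm_frame _ _ _ := norm_one
  inner_smul_frame _ _ _ v := by simp
  idx _ := ()
  mem_dom_idx _ := trivial
  contMDiffOn_inner _ _ := contMDiffOn_const

/-- The unitary frames `s ⊗ t` of the tensor product of two hermitian line bundles, where `s` and
`t` are unitary frames of the factors. -/
def tensorAtlas (L L' : HermitianLineBundle n M) :
    UnitaryFrameAtlas n (fun x ↦ L.Fiber x ⊗[ℂ] L'.Fiber x) (L.UnitaryFrame × L'.UnitaryFrame) where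
  dom i := i.1.dom ∩ i.2.dom
  isOpen_dom i := i.1.isOpen_dom.inter i.2.isOpen_dom
  frame i x := i.1.frame x ⊗ₜ i.2.frame x
  norm_frame i x hx := by
    rw [TensorProduct.norm_tmul, i.1.norm_frame x hx.1, i.2.norm_frame x hx.2, one_mul]
  inner_smul_frame i x hx v := by
    induction v using TensorProduct.induction_on with
    | zero => rw [inner_zero_right, zero_smul]
    | tmul a b =>
      rw [TensorProduct.inner_tmul, ← TensorProduct.smul_tmul_smul, i.1.inner_smul hx.1,
        i.2.inner_smul hx.2]
    | add a b ha hb => rw [inner_add_right, add_smul, ha, hb]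
  idx x := ((L.exists_unitaryFrame x).choose, (L'.exists_unitaryFrame x).choose)
  mem_dom_idx x := ⟨(L.exists_unitaryFrame x).choose_spec, (L'.exists_unitaryFrame x).choose_spec⟩
  contMDiffOn_inner i j x hx := by
    have h := ((i.1.contMDiffOn_inner j.1).mono (fun y hy ↦ ⟨hy.1.1, hy.2.1⟩) x hx).complex_mul
      ((i.2.contMDiffOn_inner j.2).mono (fun y hy ↦ ⟨hy.1.2, hy.2.2⟩) x hx)
    simpa only [TensorProduct.inner_tmul] using h

/-- The tensor product of two hermitian line bundles: the fibre over `x` is the tensor product of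
the fibres over `x` with `⟪a ⊗ b, c ⊗ d⟫ = ⟪a, c⟫ * ⟪b, d⟫`, and the tensor products of smooth local
sections are smooth. -/
def tensor (L L' : HermitianLineBundle n M) : HermitianLineBundle n M := (tensorAtlas L L').toBundle

/-- The trivial hermitian line bundle. -/
def trivial (n : ℕ) (M : Type*) [TopologicalSpace M]
    [ChartedSpace (EuclideanSpace ℝ (Fin n)) M] : HermitianLineBundle n M :=
  (trivialAtlas n M).toBundle

/-- The tensor product of two unitary frames. -/
def UnitaryFrame.tmul {L L' : HermitianLineBundle n M} (s : L.UnitaryFrame) (t : L'.UnitaryFrame) :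
    (L.tensor L').UnitaryFrame := (tensorAtlas L L').toUnitaryFrame (s, t)

/-- The constant frame `1` of the trivial bundle. -/
def UnitaryFrame.one : (trivial n M).UnitaryFrame := (trivialAtlas n M).toUnitaryFrame ()

/-- A fibrewise isometry that matches unitary frames near each point is a hermitian bundle
diffeomorphism. -/
def HermitianEquiv.ofMapFrames {L L' : HermitianLineBundle n M}
    (φ : ∀ x, L.Fiber x ≃ₗᵢ[ℂ] L'.Fiber x)
    (h : ∀ x, ∃ s : L.UnitaryFrame, ∃ t : L'.UnitaryFrame, x ∈ s.dom ∧ x ∈ t.dom ∧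
      ∀ y ∈ s.dom, y ∈ t.dom → φ y (s.frame y) = t.frame y) : HermitianEquiv L L' :=
  .ofFrames φ fun x ↦ by
    obtain ⟨s, t, hs, ht, hst⟩ := h x
    refine ⟨s, t, hs, ht, (contMDiffAt_const (c := (1 : ℂ))).congr_of_eventuallyEq ?_⟩
    filter_upwards [s.isOpen_dom.mem_nhds hs, t.isOpen_dom.mem_nhds ht] with y hys hyt
    rw [hst y hys hyt, t.inner_self hyt]

/-- The tensor product respects equivalence. -/
def tensorCongr {L₁ L₁' L₂ L₂' : HermitianLineBundle n M} (φ : HermitianEquiv L₁ L₂)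
    (ψ : HermitianEquiv L₁' L₂') : HermitianEquiv (L₁.tensor L₁') (L₂.tensor L₂') :=
  .ofFrames (fun x ↦ TensorProduct.congrIsometry (φ.fiberEquiv x) (ψ.fiberEquiv x)) fun x ↦ by
    obtain ⟨s, hs⟩ := L₁.exists_unitaryFrame x
    obtain ⟨s', hs'⟩ := L₁'.exists_unitaryFrame x
    obtain ⟨t, ht⟩ := L₂.exists_unitaryFrame x
    obtain ⟨t', ht'⟩ := L₂'.exists_unitaryFrame x
    refine ⟨s.tmul s', t.tmul t', ⟨hs, hs'⟩, ⟨ht, ht'⟩, ?_⟩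
    have h := (φ.contMDiffAt_inner s t hs ht).complex_mul (ψ.contMDiffAt_inner s' t' hs' ht')
    refine ContMDiffAt.congr_of_eventuallyEq h (.of_forall fun y ↦ ?_)
    exact TensorProduct.inner_tmul (𝕜 := ℂ) (E := L₂.Fiber y) (F := L₂'.Fiber y) _ _ _ _

/-- The tensor product is commutative up to equivalence. -/
def tensorComm (L L' : HermitianLineBundle n M) : HermitianEquiv (L.tensor L') (L'.tensor L) :=
  .ofMapFrames (fun x ↦ TensorProduct.commIsometry ℂ (L.Fiber x) (L'.Fiber x)) fun x ↦ by
    obtain ⟨s, hs⟩ := L.exists_unitaryFrame x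
    obtain ⟨s', hs'⟩ := L'.exists_unitaryFrame x
    exact ⟨s.tmul s', s'.tmul s, ⟨hs, hs'⟩, ⟨hs', hs⟩, fun y _ _ ↦ rfl⟩

/-- The tensor product is associative up to equivalence. -/
def tensorAssoc (L L' L'' : HermitianLineBundle n M) :
    HermitianEquiv ((L.tensor L').tensor L'') (L.tensor (L'.tensor L'')) :=
  .ofMapFrames (fun x ↦ TensorProduct.assocIsometry ℂ (L.Fiber x) (L'.Fiber x) (L''.Fiber x))
    fun x ↦ by
    obtain ⟨s, hs⟩ := L.exists_unitaryFrame x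
    obtain ⟨s', hs'⟩ := L'.exists_unitaryFrame x
    obtain ⟨s'', hs''⟩ := L''.exists_unitaryFrame x
    exact ⟨(s.tmul s').tmul s'', s.tmul (s'.tmul s''), ⟨⟨hs, hs'⟩, hs''⟩, ⟨hs, hs', hs''⟩,
      fun y _ _ ↦ rfl⟩

/-- The trivial bundle is a unit of the tensor product. -/
def trivialTensor (L : HermitianLineBundle n M) : HermitianEquiv ((trivial n M).tensor L) L :=
  .ofMapFrames (fun x ↦ TensorProduct.lidIsometry ℂ (L.Fiber x)) fun x ↦ by
    obtain ⟨s, hs⟩ := L.exists_unitaryFrame x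
    exact ⟨UnitaryFrame.one.tmul s, s, ⟨Set.mem_univ _, hs⟩, hs, fun y _ _ ↦ one_smul ℂ _⟩

/-- A unitary vector identifies a fibre with `ℂ`. -/
def fiberEquivComplex (L : HermitianLineBundle n M) (x : M) : L.Fiber x ≃ₗᵢ[ℂ] ℂ :=
  let s := (L.exists_unitaryFrame x).choose
  have hs : x ∈ s.dom := (L.exists_unitaryFrame x).choose_spec
  .ofSurjective
    { toLinearMap := (innerSL ℂ (s.frame x) : L.Fiber x →L[ℂ] ℂ)
      norm_map' := fun v ↦ by
        conv_rhs => rw [← s.inner_smul hs v, norm_smul, s.norm_frame x hs, mul_one]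
        rfl }
    fun z ↦ ⟨z • s.frame x, by
      change ⟪s.frame x, z • s.frame x⟫_ℂ = z
      rw [inner_smul_right, s.inner_self hs, mul_one]⟩

/-- Every hermitian line bundle has an inverse: in suitable identifications of the fibres with `ℂ`,
its unitary frames are the complex conjugates of those of `L`. -/
def inverseAtlas (L : HermitianLineBundle n M) :
    UnitaryFrameAtlas n (fun _ : M ↦ ℂ) L.UnitaryFrame where
  dom s := s.dom
  isOpen_dom s := s.isOpen_dom
  frame s x := starRingEnd ℂ (L.fiberEquivComplex x (s.frame x))
  norm_frame s x hx := by
    rw [RCLike.norm_conj, LinearIsometryEquiv.norm_map, s.norm_frame x hx]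
  inner_smul_frame s x hx v := by
    have h : L.fiberEquivComplex x (s.frame x) * starRingEnd ℂ (L.fiberEquivComplex x (s.frame x))
        = 1 := by
      rw [Complex.mul_conj, Complex.normSq_eq_norm_sq, LinearIsometryEquiv.norm_map,
        s.norm_frame x hx]
      simp
    simp only [RCLike.inner_apply, RCLike.conj_conj, smul_eq_mul]
    linear_combination v * h
  idx x := (L.exists_unitaryFrame x).choose
  mem_dom_idx x := (L.exists_unitaryFrame x).choose_spec
  contMDiffOn_inner s t := by
    refine (t.contMDiffOn_inner s).congr_mono (fun x hx ↦ ?_) (Set.inter_comm _ _).subset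
    rw [← (L.fiberEquivComplex x).inner_map_map]
    simp only [RCLike.inner_apply, RCLike.conj_conj]
    ring

/-- The tensor product of a hermitian line bundle with its inverse is trivial. -/
def inverseTensor (L : HermitianLineBundle n M) :
    HermitianEquiv ((inverseAtlas L).toBundle.tensor L) (trivial n M) :=
  .ofMapFrames (fun x ↦ (TensorProduct.lidIsometry ℂ (L.Fiber x)).trans (L.fiberEquivComplex x))
    fun x ↦ by
    obtain ⟨s, hs⟩ := L.exists_unitaryFrame x
    refine ⟨UnitaryFrame.tmul ((inverseAtlas L).toUnitaryFrame s) s, UnitaryFrame.one, ⟨hs, hs⟩,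
      Set.mem_univ _, fun y hy _ ↦ ?_⟩
    change L.fiberEquivComplex y (starRingEnd ℂ (L.fiberEquivComplex y (s.frame y)) • s.frame y) = 1
    rw [map_smul, smul_eq_mul, mul_comm, Complex.mul_conj, Complex.normSq_eq_norm_sq,
      LinearIsometryEquiv.norm_map, s.norm_frame y hy.1]
    simp

end HermitianLineBundle

/-- The set of equivalence classes of hermitian line bundles over `M`. -/
def HermitianLineBundleClass (n : ℕ) (M : Type*) [TopologicalSpace M]
    [ChartedSpace (EuclideanSpace ℝ (Fin n)) M] : Type _ :=
  Quotient (HermitianLineBundle.setoid n M)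

/-- The product of classes of hermitian line bundles: `[L] [L'] = [L ⊗ L']`. -/
def HermitianLineBundleClass.mul {n : ℕ} {M : Type*} [TopologicalSpace M]
    [ChartedSpace (EuclideanSpace ℝ (Fin n)) M] :
    HermitianLineBundleClass n M → HermitianLineBundleClass n M → HermitianLineBundleClass n M :=
  Quotient.map₂ HermitianLineBundle.tensor <| by
    rintro _ _ ⟨φ⟩ _ _ ⟨ψ⟩
    exact ⟨HermitianLineBundle.tensorCongr φ ψ⟩

/-- The group structure on equivalence classes of hermitian line bundles given by tensor products.
The identity is the class of the trivial bundle. -/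
instance HermitianLineBundleClass.instCommGroup (n : ℕ) (M : Type*) [TopologicalSpace M]
    [ChartedSpace (EuclideanSpace ℝ (Fin n)) M] : CommGroup (HermitianLineBundleClass n M) where
  mul := mul
  one := Quotient.mk _ (HermitianLineBundle.trivial n M)
  inv a := Quotient.mk _ (HermitianLineBundle.inverseAtlas a.out).toBundle
  mul_assoc := by
    rintro ⟨L⟩ ⟨L'⟩ ⟨L''⟩
    exact Quotient.sound ⟨L.tensorAssoc L' L''⟩
  one_mul := by
    rintro ⟨L⟩
    exact Quotient.sound ⟨L.trivialTensor⟩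
  mul_one := by
    rintro ⟨L⟩
    exact Quotient.sound (Setoid.trans ⟨L.tensorComm _⟩ ⟨L.trivialTensor⟩)
  inv_mul_cancel a :=
    (congrArg (mul _) a.out_eq.symm).trans
      (Quotient.sound (s := HermitianLineBundle.setoid n M) ⟨a.out.inverseTensor⟩)
  mul_comm := by
    rintro ⟨L⟩ ⟨L'⟩
    exact Quotient.sound ⟨L.tensorComm L'⟩

/-! ### Čech cohomology with constant coefficients -/

section Cech

variable (X : Type*) [TopologicalSpace X]

/-- An open cover of `X` indexed by the points of `X`: an open neighbourhood of every point.
Every open cover of `X` is refined by such a cover. -/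
structure PointedCover where
  nhd : X → Set X
  isOpen_nhd : ∀ x, IsOpen (nhd x)
  mem_nhd : ∀ x, x ∈ nhd x

variable {X}

namespace PointedCover

/-- `U ≤ V` means that `V` is finer than `U`. -/
instance : Preorder (PointedCover X) where
  le U V := ∀ x, V.nhd x ⊆ U.nhd x
  le_refl _ _ := subset_rfl
  le_trans _ _ _ h h' x := (h' x).trans (h x)

/-- The intersection `U_{σ 0} ∩ ⋯ ∩ U_{σ k}`. -/
def inter (U : PointedCover X) {k : ℕ} (σ : Fin (k + 1) → X) : Set X := {y | ∀ i, y ∈ U.nhd (σ i)}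

/-- The group of `k`-cochains of a cover with coefficients in the constant sheaf `A`: a family of
sections of the constant sheaf, that is, of locally constant functions, over the intersections of
`k + 1` members of the cover. -/
abbrev Cochain (U : PointedCover X) (A : Type*) [AddCommGroup A] (k : ℕ) : Type _ :=
  ∀ σ : Fin (k + 1) → X, LocallyConstant (U.inter σ) A

variable (A : Type*) [AddCommGroup A]

/-- Restriction of locally constant functions to a smaller set. -/
def restrict {s t : Set X} (h : s ⊆ t) : LocallyConstant t A →+ LocallyConstant s A :=
  LocallyConstant.comapAddMonoidHom ⟨Set.inclusion h, continuous_inclusion h⟩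

lemma inter_subset_face (U : PointedCover X) {k : ℕ} (σ : Fin (k + 2) → X) (j : Fin (k + 2)) :
    U.inter σ ⊆ U.inter (σ ∘ j.succAbove) := fun _ hy i ↦ hy (j.succAbove i)

lemma inter_anti {U V : PointedCover X} (h : U ≤ V) {k : ℕ} (σ : Fin (k + 1) → X) :
    V.inter σ ⊆ U.inter σ := fun _ hy i ↦ h (σ i) (hy i)

/-- The Čech differential `(dc)_{σ} = ∑ j, (-1)^j c_{σ 0, …, omit σ j, …, σ (k + 1)}`. -/
def d (U : PointedCover X) (k : ℕ) : U.Cochain A k →+ U.Cochain A (k + 1) where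
  toFun c σ := ∑ j : Fin (k + 2),
    (-1 : ℤ) ^ (j : ℕ) • restrict A (U.inter_subset_face σ j) (c (σ ∘ j.succAbove))
  map_zero' := by
    funext σ
    simp
  map_add' c c' := by
    funext σ
    simp [Finset.sum_add_distrib]

/-- The `k`-coboundaries. -/
def coboundaries (U : PointedCover X) : ∀ k, AddSubgroup (U.Cochain A k)
  | 0 => ⊥
  | k + 1 => (U.d A k).range

/-- The `k`-th Čech cohomology group of the cover `U`: cocycles modulo coboundaries. -/
abbrev Cohomology (U : PointedCover X) (k : ℕ) : Type _ :=
  (U.d A k).ker ⧸ (U.coboundaries A k).addSubgroupOf (U.d A k).ker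

/-- Restriction of cochains to a finer cover. -/
def refineCochain {U V : PointedCover X} (h : U ≤ V) (k : ℕ) : U.Cochain A k →+ V.Cochain A k where
  toFun c σ := restrict A (inter_anti h σ) (c σ)
  map_zero' := rfl
  map_add' _ _ := rfl

lemma refineCochain_d {U V : PointedCover X} (h : U ≤ V) (k : ℕ) (c : U.Cochain A k) :
    refineCochain A h (k + 1) (U.d A k c) = V.d A k (refineCochain A h k c) := by
  funext σ
  change restrict A (inter_anti h σ) (∑ j : Fin (k + 2), _) = ∑ j : Fin (k + 2), _
  rw [map_sum]
  refine Finset.sum_congr rfl fun j _ ↦ ?_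
  rw [map_zsmul]
  rfl

/-- Restriction of cocycles to a finer cover. -/
def refineCocycle {U V : PointedCover X} (h : U ≤ V) (k : ℕ) : (U.d A k).ker →+ (V.d A k).ker :=
  ((refineCochain A h k).comp (U.d A k).ker.subtype).codRestrict _ fun c ↦ by
    rw [AddMonoidHom.mem_ker, AddMonoidHom.comp_apply, ← refineCochain_d]
    have hc : U.d A k c = 0 := c.2
    rw [AddSubgroup.coe_subtype, hc, map_zero]

/-- The map induced on cohomology by passing to a finer cover. -/
def refine (U V : PointedCover X) (h : U ≤ V) (k : ℕ) :
    U.Cohomology A k →+ V.Cohomology A k :=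
  QuotientAddGroup.map _ _ (refineCocycle A h k) <| by
    rintro ⟨c, hc⟩ hb
    rw [AddSubgroup.mem_comap, AddSubgroup.mem_addSubgroupOf]
    rw [AddSubgroup.mem_addSubgroupOf] at hb
    cases k with
    | zero =>
      have hb' : c = 0 := hb
      subst hb'
      exact map_zero (refineCochain A h 0)
    | succ k =>
      obtain ⟨b, hb⟩ := hb
      refine ⟨refineCochain A h k b, ?_⟩
      rw [← refineCochain_d, hb]
      rfl

end PointedCover

open Classical in
/-- The `k`-th Čech cohomology group of `X` with coefficients in the constant sheaf `A`: the direct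
limit of the Čech cohomology groups of the open covers of `X`. -/
abbrev CechCohomology (X : Type*) [TopologicalSpace X] (A : Type*) [AddCommGroup A] (k : ℕ) :
    Type _ :=
  AddCommGroup.DirectLimit (fun U : PointedCover X ↦ U.Cohomology A k)
    fun U V h ↦ PointedCover.refine A U V h k

end Cech

end

/-!
Smooth hermitian line bundles are classified by their first Chern class, seen as a Čech class.

A hermitian line bundle `L` has unitary frames `s x` over the members of a cover, and its
transition functions `⟪s y, s x⟫` are smooth with values in the unit circle. If the cover is fine
enough, they are `exp (2 π i (a x y))` for smooth real functions `a x y`, and the Čech differential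
`a y z - a x z + a x y` is an integral `2`-cocycle. Its class is the Chern class of `L`. The
necessary refinement exists on every paracompact Hausdorff space
(`PointedCover.exists_refinement`), so that good covers are not needed.

The choices of frames and angles are not compared with each other. Instead, the Chern classes
arising from all choices form a relation between bundle classes and Čech classes, and a
multiplicative relation is the graph of an isomorphism as soon as it is total on both sides and
relates the neutral elements only to each other (`nonempty_mulEquiv_of_relation`):

* Multiplicativity: tensor products of frames have the sums of the angles
  (`HermitianLineBundle.AngleData.chernClass_tensor`).
* Every bundle has a Chern class (`HermitianLineBundle.nonempty_angleData`).
* Every integral cocycle is the differential of smooth real functions `a x y`, because averaging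
  with a partition of unity is a contracting homotopy of smooth cochains
  (`PointedCover.exists_average`). The functions `exp (2 π i (a x y))` then form a cocycle, and
  they are the transition functions of a bundle (`HermitianLineBundle.exists_chernClass_eq`).
* If `L` is trivial, then its frames are circle-valued functions. Their local logarithms show that
  the integral cocycle is the differential of an integral cochain
  (`HermitianLineBundle.AngleData.chernClass_eq_zero`).
* If the class vanishes, then an integral correction turns the angles into a smooth real cocycle.
  Averaging makes it a coboundary, which rotates the local frames into a global one
  (`HermitianLineBundle.AngleData.equiv_trivial_of_chernClass_eq_zero`).

Partitions of unity require `M` to be `σ`-compact, which follows from connectedness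
(`SigmaCompactSpace.of_paracompactSpace_of_connectedSpace`).
-/

noncomputable section

/-! ### Covers of paracompact spaces -/

open Set in
/-- The compact sets `A k` are grown from a point by adding, at each step, the closures of the
members of a locally finite cover that meet the set obtained so far. Their union is open and
closed. -/
lemma SigmaCompactSpace.of_paracompactSpace_of_connectedSpace (X : Type*) [TopologicalSpace X]
    [T2Space X] [LocallyCompactSpace X] [ParacompactSpace X] [ConnectedSpace X] :
    SigmaCompactSpace X := by
  have h (x : X) : ∃ K : Set X, IsCompact K ∧ K ∈ 𝓝 x := exists_compact_mem_nhds x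
  choose K hK hKx using h
  obtain ⟨v, hvo, hvu, hvf, hvK⟩ := precise_refinement (fun x ↦ interior (K x))
    (fun x ↦ isOpen_interior)
    (iUnion_eq_univ_iff.2 fun x ↦ ⟨x, mem_interior_iff_mem_nhds.2 (hKx x)⟩)
  have hvc (i : X) : IsCompact (closure (v i)) :=
    (hK i).of_isClosed_subset isClosed_closure
      (closure_minimal ((hvK i).trans interior_subset) (hK i).isClosed)
  obtain ⟨x₀⟩ : Nonempty X := inferInstance
  let A : ℕ → Set X := fun k ↦ Nat.rec {x₀}
    (fun _ B ↦ ⋃ i ∈ {i | (v i ∩ B).Nonempty}, closure (v i)) k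
  have hAs (k : ℕ) : A (k + 1) = ⋃ i ∈ {i | (v i ∩ A k).Nonempty}, closure (v i) := rfl
  have hA (k : ℕ) : IsCompact (A k) := by
    induction k with
    | zero => exact isCompact_singleton
    | succ k ih =>
      rw [hAs]
      exact (hvf.finite_nonempty_inter_compact ih).isCompact_biUnion fun i _ ↦ hvc i
  have hstep {k : ℕ} {i : X} (hi : (v i ∩ A k).Nonempty) : v i ⊆ A (k + 1) := by
    rw [hAs]
    exact subset_closure.trans (subset_biUnion_of_mem (u := fun i ↦ closure (v i)) hi)
  have hopen : IsOpen (⋃ k, A k) := by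
    refine isOpen_iff_mem_nhds.2 fun x hx ↦ ?_
    obtain ⟨k, hk⟩ := mem_iUnion.1 hx
    obtain ⟨i, hi⟩ := iUnion_eq_univ_iff.1 hvu x
    exact Filter.mem_of_superset ((hvo i).mem_nhds hi)
      ((hstep ⟨x, hi, hk⟩).trans (subset_iUnion A (k + 1)))
  have hclosed : IsClosed (⋃ k, A k) := by
    refine isClosed_of_closure_subset fun x hx ↦ ?_
    obtain ⟨i, hi⟩ := iUnion_eq_univ_iff.1 hvu x
    obtain ⟨y, hyv, hyA⟩ := mem_closure_iff.1 hx _ (hvo i) hi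
    obtain ⟨k, hk⟩ := mem_iUnion.1 hyA
    exact mem_iUnion.2 ⟨k + 1, hstep ⟨y, hyv, hk⟩ hi⟩
  exact ⟨A, hA, IsClopen.eq_univ ⟨hclosed, hopen⟩ ⟨x₀, mem_iUnion.2 ⟨0, mem_singleton x₀⟩⟩⟩

/-- Shrinking an open cover so that pairwise overlaps become small: if every point `p` of an
overlap `U i ∩ U j` comes with a neighbourhood `N i j p`, then there is a cover by open
neighbourhoods `V p` of the points `p`, and a refinement map `τ`, such that `V p` lies in
`N (τ p) (τ q) p` whenever `V p` meets `V q`. -/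
lemma PointedCover.exists_refinement {X ι : Type*} [TopologicalSpace X] [T2Space X]
    [ParacompactSpace X] (U : ι → Set X) (hU : ∀ i, IsOpen (U i)) (hcov : ∀ x, ∃ i, x ∈ U i)
    (N : ι → ι → X → Set X) (hN : ∀ i j, ∀ p ∈ U i ∩ U j, N i j p ∈ 𝓝 p) :
    ∃ (V : PointedCover X) (τ : X → ι), (∀ p, V.nhd p ⊆ U (τ p)) ∧
      ∀ p q, (V.nhd p ∩ V.nhd q).Nonempty →
        p ∈ U (τ p) ∩ U (τ q) ∧ V.nhd p ⊆ N (τ p) (τ q) p := by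
  obtain ⟨u, huo, huu, huf, huU⟩ := precise_refinement U hU (Set.iUnion_eq_univ_iff.2 hcov)
  obtain ⟨w, hwu, hwo, hwc⟩ := exists_iUnion_eq_closure_subset huo huf.point_finite huu
  have hwf : LocallyFinite fun i ↦ closure (w i) := huf.subset hwc
  choose τ hτ using Set.iUnion_eq_univ_iff.1 hwu
  have hev (p : X) : ∀ᶠ y in 𝓝 p, y ∈ w (τ p) ∧ (∀ i, p ∉ closure (w i) → y ∉ w i) ∧
      ∀ j, p ∈ u j → y ∈ N (τ p) j p := by
    refine Filter.Eventually.and ((hwo _).mem_nhds (hτ p)) (.and ?_ ?_)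
    · filter_upwards [hwf.iInter_compl_mem_nhds (fun i ↦ isClosed_closure) p] with y hy i hi hyi
      exact Set.mem_iInter₂.1 hy i hi (subset_closure hyi)
    · refine (Filter.eventually_all_finite (huf.point_finite p)).2 fun j hj ↦ ?_
      exact hN _ _ _ ⟨huU _ (hwc _ (subset_closure (hτ p))), huU _ hj⟩
  choose V hV hVo hpV using fun p ↦ eventually_nhds_iff.1 (hev p)
  refine ⟨⟨V, hVo, hpV⟩, τ, fun p y hy ↦ huU _ (hwc _ (subset_closure (hV p y hy).1)), ?_⟩
  rintro p q ⟨y, hyp, hyq⟩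
  -- `V p` meets `w (τ q)`, hence `p` lies in the closure of `w (τ q)`.
  have hpq : p ∈ u (τ q) := by
    by_contra hp
    exact (hV p y hyp).2.1 (τ q) (fun h ↦ hp (hwc _ h)) (hV q y hyq).1
  exact ⟨⟨huU _ (hwc _ (subset_closure (hτ p))), huU _ hpq⟩, fun z hz ↦ (hV p z hz).2.2 _ hpq⟩

/-! ### Integral Čech cochains as real functions -/

namespace PointedCover

variable {X : Type*} [TopologicalSpace X]

lemma isOpen_inter (U : PointedCover X) {k : ℕ} (σ : Fin (k + 1) → X) : IsOpen (U.inter σ) := by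
  have : U.inter σ = ⋂ i, U.nhd (σ i) := by
    ext; simp [inter]
  rw [this]
  exact isOpen_iInter_of_finite fun i ↦ U.isOpen_nhd _

instance : Nonempty (PointedCover X) :=
  ⟨⟨fun _ ↦ Set.univ, fun _ ↦ isOpen_univ, fun _ ↦ trivial⟩⟩

/-- The common refinement of two covers. -/
def inf (U V : PointedCover X) : PointedCover X where
  nhd x := U.nhd x ∩ V.nhd x
  isOpen_nhd x := (U.isOpen_nhd x).inter (V.isOpen_nhd x)
  mem_nhd x := ⟨U.mem_nhd x, V.mem_nhd x⟩

lemma le_inf_left (U V : PointedCover X) : U ≤ U.inf V := fun _ ↦ Set.inter_subset_left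

lemma le_inf_right (U V : PointedCover X) : V ≤ U.inf V := fun _ ↦ Set.inter_subset_right

instance : IsDirectedOrder (PointedCover X) :=
  ⟨fun U V ↦ ⟨U.inf V, U.le_inf_left V, U.le_inf_right V⟩⟩

instance (A : Type*) [AddCommGroup A] (k : ℕ) :
    DirectedSystem (fun U : PointedCover X ↦ U.Cohomology A k)
      fun U V h ↦ (refine A U V h k : _ → _) where
  map_self U x := by
    induction x using QuotientAddGroup.induction_on
    rfl
  map_map _ _ _ _ _ x := by
    induction x using QuotientAddGroup.induction_on
    rfl

variable (U : PointedCover X)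

open Classical in
/-- The value of the component `c σ` of an integral cochain at a point, as a real number; it is `0`
outside the domain of `c σ`. -/
def eval {k : ℕ} (c : U.Cochain ℤ k) (σ : Fin (k + 1) → X) (p : X) : ℝ :=
  if h : p ∈ U.inter σ then (c σ ⟨p, h⟩ : ℤ) else 0

variable {U}

lemma eval_of_mem {k : ℕ} (c : U.Cochain ℤ k) {σ : Fin (k + 1) → X} {p : X} (h : p ∈ U.inter σ) :
    U.eval c σ p = (c σ ⟨p, h⟩ : ℤ) := dif_pos h

lemma mem_inter_two {x y p : X} : p ∈ U.inter ![x, y] ↔ p ∈ U.nhd x ∧ p ∈ U.nhd y := by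
  simp [inter, Fin.forall_fin_succ]

lemma mem_inter_three {x y z p : X} :
    p ∈ U.inter ![x, y, z] ↔ p ∈ U.nhd x ∧ p ∈ U.nhd y ∧ p ∈ U.nhd z := by
  simp [inter, Fin.forall_fin_succ]
  tauto

lemma mem_inter_four {w x y z p : X} : p ∈ U.inter ![w, x, y, z] ↔
      p ∈ U.nhd w ∧ p ∈ U.nhd x ∧ p ∈ U.nhd y ∧ p ∈ U.nhd z := by
  simp [inter, Fin.forall_fin_succ]
  tauto

lemma cochain_ext {k : ℕ} {c c' : U.Cochain ℤ k}
    (h : ∀ σ, ∀ p ∈ U.inter σ, U.eval c σ p = U.eval c' σ p) : c = c' := by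
  funext σ
  ext ⟨p, hp⟩
  have := h σ p hp
  rw [eval_of_mem _ hp, eval_of_mem _ hp] at this
  exact_mod_cast this

lemma cochain_two_ext {c c' : U.Cochain ℤ 2}
    (h : ∀ x y z, ∀ p ∈ U.inter ![x, y, z], U.eval c ![x, y, z] p = U.eval c' ![x, y, z] p) :
    c = c' := by
  refine cochain_ext fun σ p hp ↦ ?_
  obtain ⟨x, y, z, rfl⟩ : ∃ x y z, σ = ![x, y, z] :=
    ⟨σ 0, σ 1, σ 2, by ext i; fin_cases i <;> rfl⟩
  exact h x y z p hp

lemma eval_eventually_eq {k : ℕ} (c : U.Cochain ℤ k) {σ : Fin (k + 1) → X} {p : X}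
    (h : p ∈ U.inter σ) : ∀ᶠ y in 𝓝 p, U.eval c σ y = U.eval c σ p := by
  have h1 : ∀ᶠ y : U.inter σ in 𝓝 ⟨p, h⟩, c σ y = c σ ⟨p, h⟩ :=
    (IsLocallyConstant.iff_eventually_eq _).1 (c σ).isLocallyConstant _
  rw [(U.isOpen_inter σ).isOpenEmbedding_subtypeVal.map_nhds_eq ⟨p, h⟩ |>.symm,
    Filter.eventually_map]
  filter_upwards [h1] with y hy
  rw [eval_of_mem c h, eval_of_mem c y.2, ← hy]

lemma eval_add {k : ℕ} (c c' : U.Cochain ℤ k) {σ : Fin (k + 1) → X} {p : X}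
    (h : p ∈ U.inter σ) : U.eval (c + c') σ p = U.eval c σ p + U.eval c' σ p := by
  simp [eval_of_mem _ h]

lemma eval_zero {k : ℕ} (σ : Fin (k + 1) → X) (p : X) : U.eval (0 : U.Cochain ℤ k) σ p = 0 := by
  simp [eval]

lemma eval_refineCochain {V : PointedCover X} (hUV : U ≤ V) {k : ℕ} (c : U.Cochain ℤ k)
    {σ : Fin (k + 1) → X} {p : X} (h : p ∈ V.inter σ) :
    V.eval (refineCochain ℤ hUV k c) σ p = U.eval c σ p := by
  rw [eval_of_mem _ h, eval_of_mem _ (inter_anti hUV σ h)]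
  rfl

lemma eval_d {k : ℕ} (c : U.Cochain ℤ k) {σ : Fin (k + 2) → X} {p : X} (h : p ∈ U.inter σ) :
    U.eval (U.d ℤ k c) σ p =
      ∑ j : Fin (k + 2), (-1 : ℝ) ^ (j : ℕ) * U.eval c (σ ∘ j.succAbove) p := by
  rw [eval_of_mem _ h]
  change (((∑ j : Fin (k + 2), (-1 : ℤ) ^ (j : ℕ) •
    restrict ℤ (U.inter_subset_face σ j) (c (σ ∘ j.succAbove)) : LocallyConstant _ ℤ)
      ⟨p, h⟩ : ℤ) : ℝ) = _
  rw [← LocallyConstant.coeFnAddMonoidHom_apply, map_sum, Finset.sum_apply, Int.cast_sum]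
  refine Finset.sum_congr rfl fun j _ ↦ ?_
  rw [eval_of_mem _ (U.inter_subset_face σ j h)]
  change (((-1 : ℤ) ^ (j : ℕ) • c (σ ∘ j.succAbove) ⟨p, U.inter_subset_face σ j h⟩ : ℤ) : ℝ) = _
  rw [smul_eq_mul]
  push_cast
  rfl

lemma eval_d_one (c : U.Cochain ℤ 1) {x y z p : X} (h : p ∈ U.inter ![x, y, z]) :
    U.eval (U.d ℤ 1 c) ![x, y, z] p =
      U.eval c ![y, z] p - U.eval c ![x, z] p + U.eval c ![x, y] p := by
  have h0 : ![x, y, z] ∘ (0 : Fin 3).succAbove = ![y, z] := by ext i; fin_cases i <;> rfl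
  have h1 : ![x, y, z] ∘ (1 : Fin 3).succAbove = ![x, z] := by ext i; fin_cases i <;> rfl
  have h2 : ![x, y, z] ∘ (2 : Fin 3).succAbove = ![x, y] := by ext i; fin_cases i <;> rfl
  rw [eval_d _ h, Fin.sum_univ_three, h0, h1, h2]
  norm_num
  ring

lemma eval_d_two (c : U.Cochain ℤ 2) {w x y z p : X} (h : p ∈ U.inter ![w, x, y, z]) :
    U.eval (U.d ℤ 2 c) ![w, x, y, z] p =
      U.eval c ![x, y, z] p - U.eval c ![w, y, z] p + U.eval c ![w, x, z] p
        - U.eval c ![w, x, y] p := by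
  have h0 : ![w, x, y, z] ∘ (0 : Fin 4).succAbove = ![x, y, z] := by ext i; fin_cases i <;> rfl
  have h1 : ![w, x, y, z] ∘ (1 : Fin 4).succAbove = ![w, y, z] := by ext i; fin_cases i <;> rfl
  have h2 : ![w, x, y, z] ∘ (2 : Fin 4).succAbove = ![w, x, z] := by ext i; fin_cases i <;> rfl
  have h3 : ![w, x, y, z] ∘ (3 : Fin 4).succAbove = ![w, x, y] := by ext i; fin_cases i <;> rfl
  rw [eval_d _ h, Fin.sum_univ_four, h0, h1, h2, h3]
  norm_num
  ring

/-- The cochain given by continuous real functions with integral values. Rounding turns these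
values into integers. -/
def ofReal {k : ℕ} (f : (Fin (k + 1) → X) → X → ℝ) (hf : ∀ σ, ContinuousOn (f σ) (U.inter σ))
    (hint : ∀ σ, ∀ p ∈ U.inter σ, ∃ m : ℤ, f σ p = m) : U.Cochain ℤ k := fun σ ↦
  { toFun := fun p ↦ round (f σ p)
    isLocallyConstant := by
      rw [IsLocallyConstant.iff_continuous, Int.isClosedEmbedding_coe_real.continuous_iff]
      refine (continuousOn_iff_continuous_domRestrict.1 (hf σ)).congr fun p ↦ ?_
      obtain ⟨m, hm⟩ := hint σ p p.2
      simp [hm] }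

lemma eval_ofReal {k : ℕ} (f : (Fin (k + 1) → X) → X → ℝ)
    (hf : ∀ σ, ContinuousOn (f σ) (U.inter σ))
    (hint : ∀ σ, ∀ p ∈ U.inter σ, ∃ m : ℤ, f σ p = m) {σ : Fin (k + 1) → X} {p : X}
    (h : p ∈ U.inter σ) : U.eval (ofReal f hf hint) σ p = f σ p := by
  rw [eval_of_mem _ h]
  obtain ⟨m, hm⟩ := hint σ p h
  change ((round (f σ p) : ℤ) : ℝ) = _
  simp [hm]

/-! ### Classes in the direct limit -/

open Classical in
/-- The Čech cohomology class of an integral cocycle. -/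
def cechClass {k : ℕ} (c : (U.d ℤ k).ker) : CechCohomology X ℤ k :=
  AddCommGroup.DirectLimit.of (fun U : PointedCover X ↦ U.Cohomology ℤ k) _ U
    (QuotientAddGroup.mk c)

lemma cechClass_refineCocycle {V : PointedCover X} (h : U ≤ V) {k : ℕ} (c : (U.d ℤ k).ker) :
    cechClass (refineCocycle ℤ h k c) = cechClass c := by
  classical
  exact AddCommGroup.DirectLimit.of_f (G := fun U : PointedCover X ↦ U.Cohomology ℤ k)
    (f := fun U V h ↦ PointedCover.refine ℤ U V h k) h (QuotientAddGroup.mk c)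

lemma cechClass_add {k : ℕ} (c c' : (U.d ℤ k).ker) :
    cechClass (c + c') = cechClass c + cechClass c' := by
  rw [cechClass, QuotientAddGroup.mk_add, map_add]
  rfl

lemma exists_cechClass_eq {k : ℕ} (h : CechCohomology X ℤ k) :
    ∃ (U : PointedCover X) (c : (U.d ℤ k).ker), cechClass c = h := by
  classical
  induction h using AddCommGroup.DirectLimit.induction_on with
  | ih U x =>
    induction x using QuotientAddGroup.induction_on with
    | H c => exact ⟨U, c, rfl⟩

lemma cechClass_eq_zero_of_mk_eq_zero {k : ℕ} {c : (U.d ℤ k).ker}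
    (hc : (QuotientAddGroup.mk c : U.Cohomology ℤ k) = 0) : cechClass c = 0 := by
  rw [cechClass, hc, map_zero]

lemma exists_mk_refineCocycle_eq_zero {k : ℕ} {c : (U.d ℤ k).ker} (hc : cechClass c = 0) :
    ∃ (V : PointedCover X) (h : U ≤ V),
      (QuotientAddGroup.mk (refineCocycle ℤ h k c) : V.Cohomology ℤ k) = 0 := by
  classical
  exact AddCommGroup.DirectLimit.of.zero_exact (G := fun U : PointedCover X ↦ U.Cohomology ℤ k)
    (f := fun U V h ↦ PointedCover.refine ℤ U V h k) U (QuotientAddGroup.mk c) hc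

lemma cechClass_eq_zero_iff (c : (U.d ℤ 2).ker) :
    cechClass c = 0 ↔ ∃ (V : PointedCover X) (h : U ≤ V) (b : V.Cochain ℤ 1),
      V.d ℤ 1 b = refineCochain ℤ h 2 c := by
  constructor
  · intro hc
    obtain ⟨V, h, hV⟩ := exists_mk_refineCocycle_eq_zero hc
    rw [QuotientAddGroup.eq_zero_iff, AddSubgroup.mem_addSubgroupOf] at hV
    exact ⟨V, h, hV⟩
  · rintro ⟨V, h, hb⟩
    rw [← cechClass_refineCocycle h]
    refine cechClass_eq_zero_of_mk_eq_zero ?_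
    rw [QuotientAddGroup.eq_zero_iff, AddSubgroup.mem_addSubgroupOf]
    exact hb

end PointedCover

/-! ### Phases and local logarithms -/

/-- The unit complex number `exp (2 π i t)`. -/
def phase (t : ℝ) : ℂ := Complex.exp (2 * Real.pi * t * Complex.I)

lemma phase_zero : phase 0 = 1 := by simp [phase]

lemma phase_add (s t : ℝ) : phase (s + t) = phase s * phase t := by
  rw [phase, phase, phase, ← Complex.exp_add]
  push_cast
  ring_nf

lemma norm_phase (t : ℝ) : ‖phase t‖ = 1 := by
  have : phase t = Complex.exp ((2 * Real.pi * t : ℝ) * Complex.I) := by simp [phase]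
  rw [this, Complex.norm_exp_ofReal_mul_I]

lemma conj_phase (t : ℝ) : (starRingEnd ℂ) (phase t) = phase (-t) := by
  rw [phase, phase, ← Complex.exp_conj]
  simp [map_ofNat]

lemma phase_intCast (m : ℤ) : phase m = 1 := by
  rw [phase, Complex.exp_eq_one_iff]
  exact ⟨m, by push_cast; ring⟩

lemma exists_int_of_phase_eq {s t : ℝ} (h : phase s = phase t) : ∃ m : ℤ, s - t = m := by
  have h1 : phase (s - t) = 1 := by
    rw [sub_eq_add_neg, phase_add, h, ← phase_add, add_neg_cancel, phase_zero]
  rw [phase, Complex.exp_eq_one_iff] at h1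
  obtain ⟨m, hm⟩ := h1
  refine ⟨m, ?_⟩
  have h2 : (2 * Real.pi * Complex.I : ℂ) ≠ 0 := Complex.two_pi_I_ne_zero
  have h3 : (((s - t : ℝ) : ℂ)) = ((m : ℝ) : ℂ) := by
    apply mul_left_cancel₀ h2
    push_cast at hm ⊢
    linear_combination hm
  exact_mod_cast h3

lemma contDiff_phase : ContDiff ℝ ∞ phase := by
  unfold phase
  refine ContDiff.cexp ?_
  exact (contDiff_const.mul Complex.ofRealCLM.contDiff).mul contDiff_const

section

variable {n : ℕ} {M : Type*} [TopologicalSpace M] [ChartedSpace (EuclideanSpace ℝ (Fin n)) M]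

lemma ContMDiffOn.phase {a : M → ℝ} {s : Set M} (ha : ContMDiffOn (𝓡 n) 𝓘(ℝ, ℝ) ∞ a s) :
    ContMDiffOn (𝓡 n) 𝓘(ℝ, ℂ) ∞ (fun p ↦ phase (a p)) s :=
  contDiff_phase.contMDiff.comp_contMDiffOn ha

/-- A smooth function with values in the unit circle has a smooth logarithm near each point `p`:
the principal branch, rotated so that it is centred at the value at `p`. -/
lemma exists_contMDiffOn_phase_eq {g : M → ℂ} {O : Set M} (hO : IsOpen O)
    (hg : ContMDiffOn (𝓡 n) 𝓘(ℝ, ℂ) ∞ g O) (hg1 : ∀ p ∈ O, ‖g p‖ = 1) {p : M} (hp : p ∈ O) :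
    ∃ (N : Set M) (a : M → ℝ), IsOpen N ∧ p ∈ N ∧ N ⊆ O ∧
      ContMDiffOn (𝓡 n) 𝓘(ℝ, ℝ) ∞ a N ∧ ∀ y ∈ N, phase (a y) = g y := by
  have hgp : g p ≠ 0 := fun h ↦ by simpa [h] using hg1 p hp
  have hdiv : ContMDiffOn (𝓡 n) 𝓘(ℝ, ℂ) ∞ (fun y ↦ g y / g p) O := by
    have h : ContDiff ℝ ∞ (fun z : ℂ ↦ z / g p) := contDiff_id.div_const _
    exact h.contMDiff.comp_contMDiffOn hg
  refine ⟨O ∩ (fun y ↦ g y / g p) ⁻¹' Complex.slitPlane,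
    fun y ↦ ((Complex.log (g y / g p)).im + Complex.arg (g p)) / (2 * Real.pi),
    hdiv.continuousOn.isOpen_inter_preimage hO Complex.isOpen_slitPlane,
    ⟨hp, by simp [div_self hgp]⟩, Set.inter_subset_left, ?_, ?_⟩
  · intro y hy
    have h : ContDiffAt ℝ ∞
        (fun z : ℂ ↦ ((Complex.log z).im + Complex.arg (g p)) / (2 * Real.pi)) (g y / g p) := by
      have h1 : ContDiffAt ℝ ∞ Complex.log (g y / g p) :=
        (Complex.contDiffAt_log (n := ∞) hy.2).restrict_scalars ℝ
      have h2 : ContDiffAt ℝ ∞ (fun z : ℂ ↦ (Complex.log z).im) (g y / g p) :=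
        Complex.imCLM.contDiff.contDiffAt.comp _ h1
      exact (h2.add contDiffAt_const).div_const _
    exact h.contMDiffAt.comp_contMDiffWithinAt y (hdiv.mono Set.inter_subset_left y hy)
  · intro y hy
    have h1 : Complex.exp (Complex.arg (g y / g p) * Complex.I) = g y / g p := by
      have h := Complex.norm_mul_exp_arg_mul_I (g y / g p)
      rwa [norm_div, hg1 y hy.1, hg1 p hp, div_one, Complex.ofReal_one, one_mul] at h
    have h2 : Complex.exp (Complex.arg (g p) * Complex.I) = g p := by
      have h := Complex.norm_mul_exp_arg_mul_I (g p)
      rwa [hg1 p hp, Complex.ofReal_one, one_mul] at h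
    have h3 : g y = g y / g p * g p := (div_mul_cancel₀ _ hgp).symm
    rw [h3]
    conv_rhs => rw [← h1, ← h2, ← Complex.exp_add, h2]
    simp only [phase, Complex.log_im]
    congr 1
    have : (Real.pi : ℂ) ≠ 0 := Complex.ofReal_ne_zero.2 Real.pi_ne_zero
    push_cast
    field_simp

/-! ### Averaging over a cover -/

/-- Averaging families of functions indexed by the members of a cover with the weights of a
subordinate smooth partition of unity. The operator sends families that are smooth on the members
of the cover to smooth functions, and it is a contracting homotopy of smooth Čech cochains. -/
lemma PointedCover.exists_average [T2Space M] [SigmaCompactSpace M] [IsManifold (𝓡 n) ∞ M]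
    (U : PointedCover M) :
    ∃ avg : (M → M → ℝ) →ₗ[ℝ] (M → ℝ),
      (∀ f p c, (∀ w, p ∈ U.nhd w → f w p = c) → avg f p = c) ∧
      ∀ f O, IsOpen O → (∀ w, ContMDiffOn (𝓡 n) 𝓘(ℝ, ℝ) ∞ (f w) (U.nhd w ∩ O)) →
        ContMDiffOn (𝓡 n) 𝓘(ℝ, ℝ) ∞ (avg f) O := by
  obtain ⟨ρ, hρ⟩ := SmoothPartitionOfUnity.exists_isSubordinate (𝓡 n) (s := Set.univ)
    isClosed_univ U.nhd U.isOpen_nhd fun x _ ↦ Set.mem_iUnion.2 ⟨x, U.mem_nhd x⟩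
  refine ⟨{ toFun := fun f p ↦ ∑ w ∈ ρ.finsupport p, ρ w p * f w p, map_add' := ?_,
            map_smul' := ?_ }, ?_, ?_⟩
  · intro f g
    funext p
    simp [mul_add, Finset.sum_add_distrib]
  · intro r f
    funext p
    simp only [Pi.smul_apply, smul_eq_mul, RingHom.id_apply, Finset.mul_sum]
    exact Finset.sum_congr rfl fun w _ ↦ by ring
  · intro f p c h
    change ∑ w ∈ ρ.finsupport p, ρ w p * f w p = c
    have h1 : ∀ w ∈ ρ.finsupport p, ρ w p * f w p = ρ w p * c := fun w hw ↦ by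
      rw [h w (hρ w (subset_tsupport _ ((ρ.mem_finsupport p).1 hw)))]
    rw [Finset.sum_congr rfl h1, ← Finset.sum_mul, ρ.sum_finsupport p (Set.mem_univ p), one_mul]
  · intro f O hO hf p hp
    have h := ρ.contMDiffAt_finsum (n := (⊤ : ℕ∞)) (g := f) (x₀ := p) fun w hw ↦
      (hf w).contMDiffAt (((U.isOpen_nhd w).inter hO).mem_nhds ⟨hρ w hw, hp⟩)
    refine (h.congr_of_eventuallyEq (.of_forall fun y ↦ ?_)).contMDiffWithinAt
    exact ρ.sum_finsupport_smul_eq_finsum y f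

lemma PointedCover.contMDiffOn_eval {U : PointedCover M} {k : ℕ} (c : U.Cochain ℤ k)
    (σ : Fin (k + 1) → M) : ContMDiffOn (𝓡 n) 𝓘(ℝ, ℝ) ∞ (U.eval c σ) (U.inter σ) := fun _ hp ↦
  (contMDiffAt_const.congr_of_eventuallyEq (eval_eventually_eq c hp)).contMDiffWithinAt

end

/-! ### Angles of transition functions -/

namespace HermitianLineBundle

variable {n : ℕ} {M : Type*} [TopologicalSpace M] [ChartedSpace (EuclideanSpace ℝ (Fin n)) M]

namespace UnitaryFrame

variable {L : HermitianLineBundle n M}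

lemma inner_mul_inner (s t u : L.UnitaryFrame) {x : M} (ht : x ∈ t.dom) :
    ⟪u.frame x, t.frame x⟫_ℂ * ⟪t.frame x, s.frame x⟫_ℂ = ⟪u.frame x, s.frame x⟫_ℂ := by
  conv_rhs => rw [← t.inner_smul ht (s.frame x), inner_smul_right, mul_comm]

lemma norm_inner (s t : L.UnitaryFrame) {x : M} (hs : x ∈ s.dom) (ht : x ∈ t.dom) :
    ‖⟪t.frame x, s.frame x⟫_ℂ‖ = 1 := by
  have h := congrArg norm (t.inner_smul ht (s.frame x))
  rwa [norm_smul, t.norm_frame x ht, s.norm_frame x hs, mul_one] at h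

end UnitaryFrame

/-- Unitary frames of a hermitian line bundle over the members of a cover, together with smooth
angles, in units of a full turn, of the transition functions between them. -/
structure AngleData (L : HermitianLineBundle n M) where
  cover : PointedCover M
  frame : M → L.UnitaryFrame
  nhd_subset : ∀ x, cover.nhd x ⊆ (frame x).dom
  angle : M → M → M → ℝ
  contMDiffOn_angle : ∀ x y, ContMDiffOn (𝓡 n) 𝓘(ℝ, ℝ) ∞ (angle x y)
    (cover.nhd x ∩ cover.nhd y)
  phase_angle : ∀ x y, ∀ p ∈ cover.nhd x ∩ cover.nhd y,
    phase (angle x y p) = ⟪(frame y).frame p, (frame x).frame p⟫_ℂ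

namespace AngleData

variable {L : HermitianLineBundle n M} (D : AngleData L)

lemma exists_int (x y z p : M) (h : p ∈ D.cover.inter ![x, y, z]) :
    ∃ m : ℤ, D.angle y z p - D.angle x z p + D.angle x y p = m := by
  obtain ⟨hx, hy, hz⟩ := PointedCover.mem_inter_three.1 h
  have h1 : phase (D.angle y z p + D.angle x y p) = phase (D.angle x z p) := by
    rw [phase_add, D.phase_angle _ _ _ ⟨hy, hz⟩, D.phase_angle _ _ _ ⟨hx, hy⟩,
      D.phase_angle _ _ _ ⟨hx, hz⟩, UnitaryFrame.inner_mul_inner _ _ _ (D.nhd_subset _ hy)]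
  obtain ⟨m, hm⟩ := exists_int_of_phase_eq h1
  exact ⟨m, by rw [← hm]; ring⟩

/-- The integral cochain obtained by applying the Čech differential to the angles. -/
def cochain : D.cover.Cochain ℤ 2 :=
  PointedCover.ofReal
    (fun σ p ↦ D.angle (σ 1) (σ 2) p - D.angle (σ 0) (σ 2) p + D.angle (σ 0) (σ 1) p)
    (fun σ ↦ by
      have h (i j : Fin 3) : ContinuousOn (D.angle (σ i) (σ j)) (D.cover.inter σ) :=
        (D.contMDiffOn_angle _ _).continuousOn.mono fun _ hp ↦ ⟨hp i, hp j⟩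
      exact ((h 1 2).sub (h 0 2)).add (h 0 1))
    (fun σ p hp ↦ D.exists_int _ _ _ p (PointedCover.mem_inter_three.2 ⟨hp 0, hp 1, hp 2⟩))

lemma eval_cochain {x y z p : M} (h : p ∈ D.cover.inter ![x, y, z]) :
    D.cover.eval D.cochain ![x, y, z] p =
      D.angle y z p - D.angle x z p + D.angle x y p :=
  PointedCover.eval_ofReal _ _ _ h

lemma d_cochain : D.cover.d ℤ 2 D.cochain = 0 := by
  refine PointedCover.cochain_ext fun σ p hp ↦ ?_
  obtain ⟨w, x, y, z, rfl⟩ : ∃ w x y z, σ = ![w, x, y, z] :=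
    ⟨σ 0, σ 1, σ 2, σ 3, by ext i; fin_cases i <;> rfl⟩
  obtain ⟨hw, hx, hy, hz⟩ := PointedCover.mem_inter_four.1 hp
  rw [PointedCover.eval_d_two _ hp, PointedCover.eval_zero,
    D.eval_cochain (PointedCover.mem_inter_three.2 ⟨hx, hy, hz⟩),
    D.eval_cochain (PointedCover.mem_inter_three.2 ⟨hw, hy, hz⟩),
    D.eval_cochain (PointedCover.mem_inter_three.2 ⟨hw, hx, hz⟩),
    D.eval_cochain (PointedCover.mem_inter_three.2 ⟨hw, hx, hy⟩)]
  ring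

/-- The integral cocycle of the angles. -/
def cocycle : (D.cover.d ℤ 2).ker := ⟨D.cochain, D.d_cochain⟩

/-- The Čech class of the integral cocycle of the angles. -/
def chernClass : CechCohomology M ℤ 2 := PointedCover.cechClass D.cocycle

end AngleData

end HermitianLineBundle

namespace HermitianLineBundle

variable {n : ℕ} {M : Type*} [TopologicalSpace M] [ChartedSpace (EuclideanSpace ℝ (Fin n)) M]

/-! ### Every bundle has a Chern class -/

/-- The frames of `L` are passed to a refinement whose overlaps are so small that the transition
functions have logarithms there; the overlaps themselves need not be simply connected. -/
lemma nonempty_angleData [T2Space M] [ParacompactSpace M] (L : HermitianLineBundle n M) :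
    Nonempty (AngleData L) := by
  have hlog (s t : L.UnitaryFrame) (p : M) : ∃ (N : Set M) (a : M → ℝ), p ∈ s.dom ∩ t.dom →
      IsOpen N ∧ p ∈ N ∧ ContMDiffOn (𝓡 n) 𝓘(ℝ, ℝ) ∞ a N ∧
        ∀ y ∈ N, phase (a y) = ⟪t.frame y, s.frame y⟫_ℂ := by
    by_cases hp : p ∈ s.dom ∩ t.dom
    · obtain ⟨N, a, hN, hpN, -, ha, hphase⟩ := exists_contMDiffOn_phase_eq
        (s.isOpen_dom.inter t.isOpen_dom) (s.contMDiffOn_inner t)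
        (fun y hy ↦ s.norm_inner t hy.1 hy.2) hp
      exact ⟨N, a, fun _ ↦ ⟨hN, hpN, ha, hphase⟩⟩
    · exact ⟨∅, 0, fun h ↦ absurd h hp⟩
  choose N a h using hlog
  obtain ⟨V, τ, hV, hVN⟩ := PointedCover.exists_refinement
    (fun s : L.UnitaryFrame ↦ s.dom) (fun s ↦ s.isOpen_dom) L.exists_unitaryFrame N
    fun s t p hp ↦ (h s t p hp).1.mem_nhds (h s t p hp).2.1
  refine ⟨⟨V, τ, hV, fun p q ↦ a (τ p) (τ q) p, fun p q y hy ↦ ?_, fun p q y hy ↦ ?_⟩⟩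
  · obtain ⟨hp, hN⟩ := hVN p q ⟨y, hy⟩
    exact (h _ _ _ hp).2.2.1.mono (Set.inter_subset_left.trans hN) y hy
  · obtain ⟨hp, hN⟩ := hVN p q ⟨y, hy⟩
    exact (h _ _ _ hp).2.2.2 y (hN hy.1)

/-! ### Every Čech class is a Chern class -/

/-- The angles are a smooth primitive of the cocycle, found by averaging. All fibres are `ℂ`; the
member of the cover centred at `p` provides the identification of the fibre over `p` with `ℂ`. -/
lemma exists_chernClass_eq [T2Space M] [SigmaCompactSpace M] [IsManifold (𝓡 n) ∞ M]
    (h : CechCohomology M ℤ 2) :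
    ∃ (L : HermitianLineBundle n M) (D : AngleData L), D.chernClass = h := by
  obtain ⟨U, c, rfl⟩ := PointedCover.exists_cechClass_eq h
  obtain ⟨avg, havg, havg_smooth⟩ := U.exists_average (n := n)
  let a (x y : M) : M → ℝ := avg fun w ↦ U.eval c.1 ![w, x, y]
  -- Averaging the cocycle identity of `c` over its first index shows that `d a = c`.
  have hda (x y z p : M) (hp : p ∈ U.inter ![x, y, z]) :
      a y z p - a x z p + a x y p = U.eval c.1 ![x, y, z] p := by
    have h := havg ((fun w ↦ U.eval c.1 ![w, y, z]) - (fun w ↦ U.eval c.1 ![w, x, z])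
      + fun w ↦ U.eval c.1 ![w, x, y]) p (U.eval c.1 ![x, y, z] p) fun w hw ↦ by
        have hc := PointedCover.eval_d_two c.1
          (PointedCover.mem_inter_four.2 ⟨hw, PointedCover.mem_inter_three.1 hp⟩)
        rw [show U.d ℤ 2 c.1 = 0 from c.2, PointedCover.eval_zero] at hc
        simp only [Pi.add_apply, Pi.sub_apply]
        linarith
    rw [map_add, map_sub] at h
    exact h
  have ha (x y : M) : ContMDiffOn (𝓡 n) 𝓘(ℝ, ℝ) ∞ (a x y) (U.nhd x ∩ U.nhd y) :=
    havg_smooth _ _ ((U.isOpen_nhd x).inter (U.isOpen_nhd y)) fun w ↦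
      (PointedCover.contMDiffOn_eval c.1 ![w, x, y]).mono
        fun _ hp ↦ PointedCover.mem_inter_three.2 hp
  have hinner (x y p : M) (hx : p ∈ U.nhd x) (hy : p ∈ U.nhd y) :
      ⟪phase (a y p p), phase (a x p p)⟫_ℂ = phase (a x y p) := by
    -- As `d a` is integral, the phases of `a` form a cocycle.
    have hp : p ∈ U.inter ![x, y, p] := PointedCover.mem_inter_three.2 ⟨hx, hy, U.mem_nhd p⟩
    have h1 := hda x y p p hp
    rw [PointedCover.eval_of_mem _ hp] at h1
    rw [RCLike.inner_apply, conj_phase, ← phase_add,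
      show a x p p + -a y p p = a x y p + (-(c.1 ![x, y, p] ⟨p, hp⟩) : ℤ) by push_cast; linarith,
      phase_add, phase_intCast, mul_one]
  let A : UnitaryFrameAtlas n (fun _ : M ↦ ℂ) M :=
    { dom := U.nhd
      isOpen_dom := U.isOpen_nhd
      frame := fun x p ↦ phase (a x p p)
      norm_frame := fun x p _ ↦ norm_phase _
      inner_smul_frame := fun x p _ v ↦ by
        rw [RCLike.inner_apply, conj_phase, smul_eq_mul, mul_assoc, ← phase_add, neg_add_cancel,
          phase_zero, mul_one]
      idx := id
      mem_dom_idx := U.mem_nhd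
      contMDiffOn_inner := fun x y ↦ (ha x y).phase.congr fun p hp ↦ hinner x y p hp.1 hp.2 }
  let D : AngleData A.toBundle :=
    { cover := U
      frame := A.toUnitaryFrame
      nhd_subset := fun _ ↦ subset_rfl
      angle := a
      contMDiffOn_angle := ha
      phase_angle := fun x y p hp ↦ (hinner x y p hp.1 hp.2).symm }
  refine ⟨A.toBundle, D, congrArg PointedCover.cechClass (Subtype.ext ?_)⟩
  refine PointedCover.cochain_two_ext fun x y z p hp ↦ ?_
  exact (D.eval_cochain hp).trans (hda x y z p hp)

namespace AngleData

/-! ### Tensor products and sums of classes -/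

variable {L L' : HermitianLineBundle n M}

/-- The tensor products of the frames have the sums of the angles. -/
def tensor (D : AngleData L) (D' : AngleData L') : AngleData (L.tensor L') where
  cover := D.cover.inf D'.cover
  frame x := (D.frame x).tmul (D'.frame x)
  nhd_subset x := Set.inter_subset_inter (D.nhd_subset x) (D'.nhd_subset x)
  angle x y p := D.angle x y p + D'.angle x y p
  contMDiffOn_angle x y :=
    ((D.contMDiffOn_angle x y).mono fun _ hp ↦ ⟨hp.1.1, hp.2.1⟩).add
      ((D'.contMDiffOn_angle x y).mono fun _ hp ↦ ⟨hp.1.2, hp.2.2⟩)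
  phase_angle x y p hp := by
    rw [phase_add, D.phase_angle x y p ⟨hp.1.1, hp.2.1⟩, D'.phase_angle x y p ⟨hp.1.2, hp.2.2⟩]
    exact (TensorProduct.inner_tmul (𝕜 := ℂ) (E := L.Fiber p) (F := L'.Fiber p) _ _ _ _).symm

lemma chernClass_tensor (D : AngleData L) (D' : AngleData L') :
    (D.tensor D').chernClass = D.chernClass + D'.chernClass := by
  rw [chernClass, chernClass, chernClass,
    ← PointedCover.cechClass_refineCocycle (D.cover.le_inf_left D'.cover),
    ← PointedCover.cechClass_refineCocycle (D.cover.le_inf_right D'.cover),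
    ← PointedCover.cechClass_add]
  refine congrArg PointedCover.cechClass (Subtype.ext ?_)
  refine PointedCover.cochain_two_ext fun x y z p hp ↦ ?_
  refine ((D.tensor D').eval_cochain hp).trans ?_
  refine Eq.trans ?_ (PointedCover.eval_add _ _ hp).symm
  have hl := D.cover.le_inf_left D'.cover
  have hr := D.cover.le_inf_right D'.cover
  refine Eq.trans ?_ (congrArg₂ (fun s t : ℝ ↦ s + t)
    (PointedCover.eval_refineCochain hl D.cochain hp)
    (PointedCover.eval_refineCochain hr D'.cochain hp)).symm
  rw [D.eval_cochain (PointedCover.inter_anti hl _ hp),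
    D'.eval_cochain (PointedCover.inter_anti hr _ hp)]
  change _ + _ - (_ + _) + (_ + _) = _
  ring

/-! ### The class detects triviality -/

/-- If `L` is trivial, then its frames are unitary functions, which have local logarithms `b x`. The
angles differ from `b x - b y` by an integral cochain, whose differential is the cocycle. -/
lemma chernClass_eq_zero (D : AngleData L) (φ : HermitianEquiv L (trivial n M)) :
    D.chernClass = 0 := by
  have hlog (x : M) : ∃ (N : Set M) (b : M → ℝ), IsOpen N ∧ x ∈ N ∧ N ⊆ D.cover.nhd x ∧
      ContMDiffOn (𝓡 n) 𝓘(ℝ, ℝ) ∞ b N ∧ ∀ y ∈ N, phase (b y) =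
        ⟪(UnitaryFrame.one (n := n) (M := M)).frame y, φ.fiberEquiv y ((D.frame x).frame y)⟫_ℂ := by
    refine exists_contMDiffOn_phase_eq (D.cover.isOpen_nhd x) (fun y hy ↦ ?_) (fun y hy ↦ ?_)
      (D.cover.mem_nhd x)
    · exact (φ.contMDiffAt_inner _ _ (D.nhd_subset x hy) (Set.mem_univ y)).contMDiffWithinAt
    · have h := (UnitaryFrame.one (n := n) (M := M)).inner_smul (Set.mem_univ y)
        (φ.fiberEquiv y ((D.frame x).frame y))
      have h' := congrArg norm h
      rwa [norm_smul, (UnitaryFrame.one (n := n) (M := M)).norm_frame y (Set.mem_univ y), mul_one,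
        LinearIsometryEquiv.norm_map, (D.frame x).norm_frame y (D.nhd_subset x hy)] at h'
  choose N b hN hxN hNU hb hphase using hlog
  let V : PointedCover M := ⟨N, hN, hxN⟩
  have hUV : D.cover ≤ V := hNU
  have hint (x y p : M) (hx : p ∈ N x) (hy : p ∈ N y) :
      ∃ m : ℤ, D.angle x y p - (b x p - b y p) = m := by
    refine exists_int_of_phase_eq ?_
    rw [D.phase_angle x y p ⟨hNU x hx, hNU y hy⟩, sub_eq_add_neg, phase_add, ← conj_phase,
      hphase x p hx, hphase y p hy, inner_conj_symm, mul_comm,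
      ← (φ.fiberEquiv p).inner_map_map]
    conv_lhs => rw [← (UnitaryFrame.one (n := n) (M := M)).inner_smul (Set.mem_univ p)
      (φ.fiberEquiv p ((D.frame x).frame p)), inner_smul_right, mul_comm]
  let m : V.Cochain ℤ 1 := PointedCover.ofReal
    (fun σ p ↦ D.angle (σ 0) (σ 1) p - (b (σ 0) p - b (σ 1) p))
    (fun σ ↦ by
      have h (i : Fin 2) : ContinuousOn (b (σ i)) (V.inter σ) :=
        (hb _).continuousOn.mono fun p hp ↦ hp i
      have h' : ContinuousOn (D.angle (σ 0) (σ 1)) (V.inter σ) :=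
        (D.contMDiffOn_angle _ _).continuousOn.mono fun p hp ↦ ⟨hNU _ (hp 0), hNU _ (hp 1)⟩
      exact h'.sub ((h 0).sub (h 1)))
    fun σ p hp ↦ hint _ _ p (hp 0) (hp 1)
  have hm (x y p : M) (hp : p ∈ V.inter ![x, y]) :
      V.eval m ![x, y] p = D.angle x y p - (b x p - b y p) := PointedCover.eval_ofReal _ _ _ hp
  refine (PointedCover.cechClass_eq_zero_iff _).2 ⟨V, hUV, m, ?_⟩
  refine PointedCover.cochain_two_ext fun x y z p hp ↦ ?_
  obtain ⟨hx, hy, hz⟩ := PointedCover.mem_inter_three.1 hp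
  refine Eq.trans ?_ (PointedCover.eval_refineCochain hUV D.cochain hp).symm
  rw [D.eval_cochain (PointedCover.inter_anti hUV _ hp), PointedCover.eval_d_one _ hp,
    hm _ _ _ (PointedCover.mem_inter_two.2 ⟨hy, hz⟩),
    hm _ _ _ (PointedCover.mem_inter_two.2 ⟨hx, hz⟩),
    hm _ _ _ (PointedCover.mem_inter_two.2 ⟨hx, hy⟩)]
  ring

/-- If the class vanishes, then integers can be subtracted from the angles so that they become a
smooth real cocycle. Averaging writes this cocycle as `b y - b x`, and the frames rotated by `b x`
agree on overlaps: they form a global frame. -/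
lemma equiv_trivial_of_chernClass_eq_zero [T2Space M] [SigmaCompactSpace M]
    [IsManifold (𝓡 n) ∞ M] (D : AngleData L) (hD : D.chernClass = 0) :
    Nonempty (HermitianEquiv L (trivial n M)) := by
  obtain ⟨V, hUV, m, hm⟩ := (PointedCover.cechClass_eq_zero_iff _).1 hD
  obtain ⟨avg, havg, havg_smooth⟩ := V.exists_average (n := n)
  let a (x y : M) : M → ℝ := fun p ↦ D.angle x y p - V.eval m ![x, y] p
  have hda (x y z p : M) (hx : p ∈ V.nhd x) (hy : p ∈ V.nhd y) (hz : p ∈ V.nhd z) :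
      a y z p - a x z p + a x y p = 0 := by
    have hp : p ∈ V.inter ![x, y, z] := PointedCover.mem_inter_three.2 ⟨hx, hy, hz⟩
    have h1 := PointedCover.eval_d_one m hp
    have h2 := (PointedCover.eval_refineCochain hUV D.cochain hp).trans
      (D.eval_cochain (PointedCover.inter_anti hUV _ hp))
    have h3 : V.eval (V.d ℤ 1 m) ![x, y, z] p =
        V.eval (PointedCover.refineCochain ℤ hUV 2 D.cochain) ![x, y, z] p := by rw [hm]; rfl
    simp only [a]
    linarith
  have ha (x y : M) : ContMDiffOn (𝓡 n) 𝓘(ℝ, ℝ) ∞ (a x y) (V.nhd x ∩ V.nhd y) :=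
    ((D.contMDiffOn_angle x y).mono (Set.inter_subset_inter (hUV x) (hUV y))).sub
      ((PointedCover.contMDiffOn_eval m ![x, y]).mono fun _ hp ↦ PointedCover.mem_inter_two.2 hp)
  let b (x : M) : M → ℝ := avg fun w ↦ a w x
  have hb (x : M) : ContMDiffOn (𝓡 n) 𝓘(ℝ, ℝ) ∞ (b x) (V.nhd x) :=
    havg_smooth _ _ (V.isOpen_nhd x) fun w ↦ ha w x
  have hdb (x y p : M) (hx : p ∈ V.nhd x) (hy : p ∈ V.nhd y) : b y p - b x p = a x y p := by
    have h := havg ((fun w ↦ a w y) - fun w ↦ a w x) p (a x y p) fun w hw ↦ by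
      have := hda w x y p hw hx hy
      simp only [Pi.sub_apply]
      linarith
    rw [map_sub] at h
    exact h
  have hphase (x y p : M) (hx : p ∈ V.nhd x) (hy : p ∈ V.nhd y) :
      ⟪(D.frame y).frame p, (D.frame x).frame p⟫_ℂ = phase (b y p - b x p) := by
    have hp : p ∈ V.inter ![x, y] := PointedCover.mem_inter_two.2 ⟨hx, hy⟩
    rw [← D.phase_angle x y p ⟨hUV x hx, hUV y hy⟩, hdb x y p hx hy,
      show D.angle x y p = a x y p + V.eval m ![x, y] p by simp [a], phase_add,
      PointedCover.eval_of_mem _ hp, phase_intCast, mul_one]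
  -- The coefficient of a vector with respect to the global frame, read off at `p` from the member
  -- of the cover centred at `p`.
  let ψ (p : M) : L.Fiber p ≃ₗᵢ[ℂ] ℂ := .ofSurjective
    { toLinearMap := phase (-b p p) • (innerSL ℂ ((D.frame p).frame p) : L.Fiber p →L[ℂ] ℂ)
      norm_map' := fun v ↦ by
        have hp := D.nhd_subset p (D.cover.mem_nhd p)
        conv_rhs => rw [← (D.frame p).inner_smul hp v, norm_smul, (D.frame p).norm_frame p hp,
          mul_one]
        change ‖phase (-b p p) * ⟪(D.frame p).frame p, v⟫_ℂ‖ = _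
        rw [norm_mul, norm_phase, one_mul] }
    fun z ↦ ⟨(z * phase (b p p)) • (D.frame p).frame p, by
      change phase (-b p p) * ⟪(D.frame p).frame p, (z * phase (b p p)) • (D.frame p).frame p⟫_ℂ = z
      rw [inner_smul_right, (D.frame p).inner_self (D.nhd_subset p (D.cover.mem_nhd p)), mul_one,
        mul_left_comm, ← phase_add, neg_add_cancel, phase_zero, mul_one]⟩
  have hψ (x p : M) (hx : p ∈ V.nhd x) : ψ p ((D.frame x).frame p) = phase (-b x p) := by
    change phase (-b p p) * ⟪(D.frame p).frame p, (D.frame x).frame p⟫_ℂ = _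
    rw [hphase x p p hx (V.mem_nhd p), ← phase_add]
    ring_nf
  refine ⟨HermitianEquiv.ofFrames (L' := trivial n M) ψ fun x ↦ ⟨D.frame x, UnitaryFrame.one,
    D.nhd_subset x (D.cover.mem_nhd x), Set.mem_univ x, ?_⟩⟩
  have h : ContMDiffAt (𝓡 n) 𝓘(ℝ, ℂ) ∞ (fun p ↦ phase (-b x p)) x :=
    (hb x).neg.phase.contMDiffAt ((V.isOpen_nhd x).mem_nhds (V.mem_nhd x))
  refine h.congr_of_eventuallyEq ?_
  filter_upwards [(V.isOpen_nhd x).mem_nhds (V.mem_nhd x)] with p hp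
  change ⟪(1 : ℂ), ψ p ((D.frame x).frame p)⟫_ℂ = _
  rw [hψ x p hp, RCLike.inner_apply, map_one, mul_one]

end AngleData

end HermitianLineBundle

/-! ### The isomorphism -/

/-- A multiplicative relation between two groups that is total on both sides and relates the
neutral elements only to each other is the graph of an isomorphism. -/
lemma nonempty_mulEquiv_of_relation {G H : Type*} [Group G] [Group H] (R : G → H → Prop)
    (mul : ∀ g g' h h', R g h → R g' h' → R (g * g') (h * h')) (exists_right : ∀ g, ∃ h, R g h)
    (exists_left : ∀ h, ∃ g, R g h) (right_eq_one : ∀ h, R 1 h → h = 1)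
    (left_eq_one : ∀ g, R g 1 → g = 1) : Nonempty (G ≃* H) := by
  have right_unique {g h h'} (hh : R g h) (hh' : R g h') : h = h' := by
    obtain ⟨k, hk⟩ := exists_right g⁻¹
    have h1 := right_eq_one _ (mul_inv_cancel g ▸ mul _ _ _ _ hh hk)
    have h2 := right_eq_one _ (mul_inv_cancel g ▸ mul _ _ _ _ hh' hk)
    exact mul_right_cancel (h1.trans h2.symm)
  have left_unique {g g' h} (hg : R g h) (hg' : R g' h) : g = g' := by
    obtain ⟨k, hk⟩ := exists_left h⁻¹
    have h1 := left_eq_one _ (mul_inv_cancel h ▸ mul _ _ _ _ hg hk)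
    have h2 := left_eq_one _ (mul_inv_cancel h ▸ mul _ _ _ _ hg' hk)
    exact mul_right_cancel (h1.trans h2.symm)
  choose f hf using exists_right
  refine ⟨MulEquiv.ofBijective (MonoidHom.mk' f fun g g' ↦
    right_unique (hf _) (mul _ _ _ _ (hf g) (hf g'))) ⟨fun g g' h ↦ ?_, fun h ↦ ?_⟩⟩
  · exact left_unique (hf g) ((show f g = f g' from h) ▸ hf g')
  · obtain ⟨g, hg⟩ := exists_left h
    exact ⟨g, right_unique (hf g) hg⟩

/-- The relation between the class of a hermitian line bundle and the Čech classes of the angles of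
its transition functions. -/
def HermitianLineBundleClass.HasChernClass {n : ℕ} {M : Type*} [TopologicalSpace M]
    [ChartedSpace (EuclideanSpace ℝ (Fin n)) M] (γ : HermitianLineBundleClass n M)
    (h : CechCohomology M ℤ 2) : Prop :=
  ∃ (L : HermitianLineBundle n M) (D : L.AngleData), Quotient.mk _ L = γ ∧ D.chernClass = h

end
theorem mainTheorem2 (n : ℕ) (M : Type*) [TopologicalSpace M] [T2Space M] [ParacompactSpace M]
    [ConnectedSpace M] [ChartedSpace (EuclideanSpace ℝ (Fin n)) M] [IsManifold (𝓡 n) ∞ M] :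
    Nonempty (HermitianLineBundleClass n M ≃* Multiplicative (CechCohomology M ℤ 2)) := by
  have : LocallyCompactSpace M := ChartedSpace.locallyCompactSpace (EuclideanSpace ℝ (Fin n)) M
  have : SigmaCompactSpace M := .of_paracompactSpace_of_connectedSpace M
  refine nonempty_mulEquiv_of_relation 
    (fun (γ : HermitianLineBundleClass n M) (h : Multiplicative (CechCohomology M ℤ 2)) ↦
      γ.HasChernClass h.toAdd) ?_ ?_ ?_ ?_ ?_
  · rintro _ _ _ _ ⟨L, D, rfl, hD⟩ ⟨L', D', rfl, hD'⟩
    exact ⟨L.tensor L', D.tensor D', rfl, by rw [D.chernClass_tensor, hD, hD']; rfl⟩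
  · rintro ⟨L⟩
    obtain ⟨D⟩ := L.nonempty_angleData
    exact ⟨.ofAdd D.chernClass, L, D, rfl, rfl⟩
  · intro h
    obtain ⟨L, D, hD⟩ := HermitianLineBundle.exists_chernClass_eq (n := n) h.toAdd
    exact ⟨Quotient.mk _ L, L, D, rfl, hD⟩
  · rintro h ⟨L, D, hL, hD⟩
    obtain ⟨φ⟩ : Nonempty (L.HermitianEquiv (.trivial n M)) := Quotient.exact hL
    exact hD.symm.trans (D.chernClass_eq_zero φ)
  · rintro _ ⟨L, D, rfl, hD⟩
    exact Quotient.sound (D.equiv_trivial_of_chernClass_eq_zero hD)
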